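/- Let $k$ be a field and $q\in k^{\times}$. Let $H_q$ be the $k$-algebra generated by $D_1,D_2,\sigma^{\pm1}$ with relations $\sigma\sigma^{-1}=\sigma^{-1}\sigma=1$, $D_1D_2=D_2D_1$, $q\sigma D_i=D_i\sigma$ for $i=1,2$, and moreover $D_1^l=D_2^l=0$ if $q$ is a primitive $l$-th root of unity with $l\ge 2$. It is a Hopf algebra with $\Delta(D_1)=D_1\otimes\sigma+1\otimes D_1$, $\Delta(D_2)=D_2\otimes1+\sigma\otimes D_2$, $\Delta(\sigma)=\sigma\otimes\sigma$, $\epsilon(D_i)=0$, $\epsilon(\sigma)=1$. Let $G$ be a group with a representation $(g,v)\mapsto{}^gv$ on a finite-dimensional $k$-vector space $V$, let $f\colon G\times G\to k^{\times}$ be a normal (normalized) $2$-cocycle for the trivial action, and let $A=S(V)\#_fG$ be the crossed product: the free left $S(V)$-module with basis $\{w_g:g\in G\}$ and product $(Pw_g)(Qw_h)=P\,{}^gQ\,f(g,h)\,w_{gh}$. Fix a group homomorphism $\chi_\alpha\colon G\to k^{\times}$ and a bijective $k[G]$-linear map $\hat\alpha\colon V\to V$. Let $\alpha$ be the automorphism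 of $A$ with $\alpha(v_1\cdots v_mw_g)=\hat\alpha(v_1)\cdots\hat\alpha(v_m)\chi_\alpha(g)w_g$, and let $s\colon H_q\otimes A\to A\otimes H_q$ be the good transposition associated with $\alpha$, that is, $s(\sigma^iD_1^jD_2^m\otimes a)=\alpha^{j-m}(a)\otimes\sigma^iD_1^jD_2^m$. An $H_q$-module algebra structure on $(A,s)$ is an action $\rho\colon H_q\otimes A\to A$, $\rho(h\otimes a)=h\cdot a$, making $A$ a left $H_q$-module, such that ($s$ being a bijective map compatible with the algebra and coalgebra structures of $H_q$, with the flip $\tau$ of $H_q\otimes H_q$ and with the algebra structure of $A$) $s\circ(H_q\otimes\rho)=(\rho\otimes H_q)\circ(H_q\otimes s)\circ(\tau\otimes A)$, $\rho\circ(H_q\otimes\mu_A)=\mu_A\circ(\rho\otimes\rho)\circ(H_q\otimes s\otimes A)\circ(\Delta\otimes A\otimes A)$, where $\mu_A$ is the multiplication of $A$, and $h\cdot1=\epsilon(h)1$ for all $h\in H_q$. Let $\hat\delta_1,\hat\delta_2\colon V\to A$ and $\hat\varsigma\colon V\to V$ be $k$-linear maps and let $\bar\delta_1,\bar\delta_2\colon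 G\to A$ and $\chi_\varsigma\colon G\to k^{\times}$ be maps. Let $\varsigma\colon A\to A$ be the $k$-linear map with $\varsigma(v_1\cdots v_mw_g)=\hat\varsigma(v_1)\cdots\hat\varsigma(v_m)\chi_\varsigma(g)w_g$. **Theorem.** There is an $H_q$-module algebra structure on $(A,s)$ such that $$\sigma\cdot v=\hat\varsigma(v),\quad \sigma\cdot w_g=\chi_\varsigma(g)w_g,\quad D_i\cdot v=\hat\delta_i(v),\quad D_i\cdot w_g=\bar\delta_i(g)$$ for all $v\in V$, $g\in G$ and $i\in\{1,2\}$, if and only if the following hold. 1. $\hat\varsigma$ is bijective and $k[G]$-linear, and $\chi_\varsigma$ is a group homomorphism. 2. For all $v,w\in V$ and $g,h\in G$: * $\hat\delta_1(v)\hat\varsigma(w)+\hat\alpha(v)\hat\delta_1(w)=\hat\delta_1(w)\hat\varsigma(v)+\hat\alpha(w)\hat\delta_1(v)$, * $\hat\delta_2(v)w+\hat\varsigma(\hat\alpha^{-1}(v))\hat\delta_2(w)=\hat\delta_2(w)v+\hat\varsigma(\hat\alpha^{-1}(w))\hat\delta_2(v)$, * $\hat\delta_1({}^gv)\chi_\varsigma(g)w_g+\hat\alpha({}^gv)\bar\delta_1(g)=\bar\delta_1(g)\hat\varsigma(v)+\chi_\alpha(g)w_g\hat\delta_1(v)$,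 * $f(g,h)\bar\delta_1(gh)=\bar\delta_1(g)\chi_\varsigma(h)w_h+\chi_\alpha(g)w_g\bar\delta_1(h)$, * $\hat\delta_2({}^gv)w_g+\hat\varsigma(\hat\alpha^{-1}({}^gv))\bar\delta_2(g)=\bar\delta_2(g)v+\chi_\varsigma(g)\chi_\alpha(g)^{-1}w_g\hat\delta_2(v)$, * $f(g,h)\bar\delta_2(gh)=\bar\delta_2(g)w_h+\chi_\varsigma(g)\chi_\alpha(g)^{-1}w_g\bar\delta_2(h)$. 3. $\hat\delta_i\circ\hat\alpha=\alpha\circ\hat\delta_i$ for $i=1,2$. 4. $\chi_\alpha(g)\bar\delta_i(g)=\alpha(\bar\delta_i(g))$ for all $g\in G$ and $i=1,2$. 5. $\hat\varsigma\circ\hat\alpha=\hat\alpha\circ\hat\varsigma$. 6. The $k$-linear maps $\delta_1,\delta_2\colon A\to A$ given by $$\delta_1(v_1\cdots v_mw_g)=\sum_{j=1}^m\alpha(v_1\cdots v_{j-1})\hat\delta_1(v_j)\varsigma(v_{j+1}\cdots v_mw_g)+\alpha(v_1\cdots v_m)\bar\delta_1(g),$$ $$\delta_2(v_1\cdots v_mw_g)=\sum_{j=1}^m\varsigma(\alpha^{-1}(v_1\cdots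 v_{j-1}))\hat\delta_2(v_j)v_{j+1}\cdots v_mw_g+\varsigma(\alpha^{-1}(v_1\cdots v_m))\bar\delta_2(g)$$ (which are well defined by the first two equalities in item 2) satisfy $\delta_2\circ\hat\delta_1=\delta_1\circ\hat\delta_2$, $\delta_2\circ\bar\delta_1=\delta_1\circ\bar\delta_2$, $\hat\delta_i\circ\hat\varsigma=q\,\varsigma\circ\hat\delta_i$ and $\chi_\varsigma(g)\bar\delta_i(g)=q\,\varsigma(\bar\delta_i(g))$ for all $g\in G$ and $i=1,2$, and $\delta_1^l=\delta_2^l=0$ if $q$ is a primitive $l$-th root of unity with $l\ge2$. -/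

import Mathlib

open scoped TensorProduct

noncomputable section

namespace HqMod

/-! ### Module algebras over a braided bialgebra -/

section Braided

variable {k H A : Type*} [Field k] [Ring H] [Bialgebra k H] [Ring A] [Algebra k A]

/-- The map `(s ⊗ H) ∘ (H ⊗ s) : H ⊗ H ⊗ A → A ⊗ H ⊗ H`. -/
def slideTwo (s : H ⊗[k] A →ₗ[k] A ⊗[k] H) : H ⊗[k] (H ⊗[k] A) →ₗ[k] A ⊗[k] (H ⊗[k] H) :=
  (TensorProduct.assoc k A H H).toLinearMap ∘ₗ s.rTensor H ∘ₗ
    (TensorProduct.assoc k H A H).symm.toLinearMap ∘ₗ s.lTensor H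

/-- The map `(A ⊗ s) ∘ (s ⊗ A) : H ⊗ A ⊗ A → A ⊗ A ⊗ H`. -/
def slidePast (s : H ⊗[k] A →ₗ[k] A ⊗[k] H) : H ⊗[k] (A ⊗[k] A) →ₗ[k] (A ⊗[k] A) ⊗[k] H :=
  (TensorProduct.assoc k A A H).symm.toLinearMap ∘ₗ s.lTensor A ∘ₗ
    (TensorProduct.assoc k A H A).toLinearMap ∘ₗ s.rTensor A ∘ₗ
      (TensorProduct.assoc k H A A).symm.toLinearMap

/-- The map `H ⊗ s ⊗ A : (H ⊗ H) ⊗ (A ⊗ A) → (H ⊗ A) ⊗ (H ⊗ A)`. -/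
def slideMid (s : H ⊗[k] A →ₗ[k] A ⊗[k] H) :
    (H ⊗[k] H) ⊗[k] (A ⊗[k] A) →ₗ[k] (H ⊗[k] A) ⊗[k] (H ⊗[k] A) :=
  (TensorProduct.assoc k H A (H ⊗[k] A)).symm.toLinearMap ∘ₗ
    LinearMap.lTensor H ((TensorProduct.assoc k A H A).toLinearMap ∘ₗ s.rTensor A ∘ₗ
      (TensorProduct.assoc k H A A).symm.toLinearMap) ∘ₗ
        (TensorProduct.assoc k H H (A ⊗[k] A)).toLinearMap

/-- `s` is a left transposition of `H` (with braid `c`) on the algebra `A`: a bijective linear map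
`H ⊗ A → A ⊗ H` compatible with the unit, multiplication, counit, comultiplication and braid of
`H`, and with the unit and the multiplication of `A`. -/
structure IsLeftTransposition (c : H ⊗[k] H ≃ₗ[k] H ⊗[k] H)
    (s : H ⊗[k] A →ₗ[k] A ⊗[k] H) : Prop where
  bijective : Function.Bijective s
  one_tmul : ∀ a : A, s (1 ⊗ₜ a) = a ⊗ₜ 1
  mul_tmul : ∀ (h l : H) (a : A),
    s ((h * l) ⊗ₜ a) = (LinearMap.mul' k H).lTensor A (slideTwo s (h ⊗ₜ (l ⊗ₜ a)))
  counit_tmul : ∀ (h : H) (a : A),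
    (Coalgebra.counit (R := k) (A := H)).lTensor A (s (h ⊗ₜ a)) =
      a ⊗ₜ Coalgebra.counit (R := k) h
  comul_tmul : ∀ (h : H) (a : A),
    (Coalgebra.comul (R := k) (A := H)).lTensor A (s (h ⊗ₜ a)) =
      slideTwo s (TensorProduct.assoc k H H A (Coalgebra.comul (R := k) h ⊗ₜ a))
  braid_tmul : ∀ (h l : H) (a : A),
    slideTwo s (TensorProduct.assoc k H H A (c (h ⊗ₜ l) ⊗ₜ a)) =
      c.toLinearMap.lTensor A (slideTwo s (h ⊗ₜ (l ⊗ₜ a)))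
  tmul_one : ∀ h : H, s (h ⊗ₜ 1) = 1 ⊗ₜ h
  tmul_mul : ∀ (h : H) (a b : A),
    s (h ⊗ₜ (a * b)) = (LinearMap.mul' k A).rTensor H (slidePast s (h ⊗ₜ (a ⊗ₜ b)))

/-- `(A, s)` is a left `H`-module algebra (`H` with braid `c`) via the action `ρ`. -/
structure IsModuleAlgebra (c : H ⊗[k] H ≃ₗ[k] H ⊗[k] H)
    (s : H ⊗[k] A →ₗ[k] A ⊗[k] H) (ρ : H ⊗[k] A →ₗ[k] A) : Prop where
  transposition : IsLeftTransposition c s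
  one_act : ∀ a : A, ρ (1 ⊗ₜ a) = a
  mul_act : ∀ (h l : H) (a : A), ρ ((h * l) ⊗ₜ a) = ρ (h ⊗ₜ ρ (l ⊗ₜ a))
  braid_act : ∀ (h l : H) (a : A),
    s (h ⊗ₜ ρ (l ⊗ₜ a)) = ρ.rTensor H ((TensorProduct.assoc k H A H).symm
      (s.lTensor H (TensorProduct.assoc k H H A (c (h ⊗ₜ l) ⊗ₜ a))))
  act_mul : ∀ (h : H) (a b : A),
    ρ (h ⊗ₜ (a * b)) = LinearMap.mul' k A (TensorProduct.map ρ ρ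
      (slideMid s (Coalgebra.comul (R := k) h ⊗ₜ (a ⊗ₜ b))))
  act_one : ∀ h : H, ρ (h ⊗ₜ 1) = Coalgebra.counit (R := k) h • (1 : A)

end Braided

/-! ### The binomial formula at a root of unity -/

section QBinomial

variable {k : Type*} [Field k]

/-- Gaussian binomial coefficients, by their Pascal rule. -/
def gaussBinom (q : k) : ℕ → ℕ → k
  | _, 0 => 1
  | 0, _ + 1 => 0
  | n + 1, i + 1 => gaussBinom q n i + q ^ (i + 1) * gaussBinom q n (i + 1)

theorem gaussBinom_zero (q : k) (n : ℕ) : gaussBinom q n 0 = 1 := by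
  cases n <;> rfl

theorem gaussBinom_of_lt (q : k) : ∀ n i : ℕ, n < i → gaussBinom q n i = 0
  | _, 0, h => absurd h (Nat.not_lt_zero _)
  | 0, _ + 1, _ => rfl
  | n + 1, i + 1, h => by
    rw [gaussBinom, gaussBinom_of_lt q n i (by omega), gaussBinom_of_lt q n (i + 1) (by omega)]
    simp

theorem gaussBinom_self (q : k) : ∀ n : ℕ, gaussBinom q n n = 1
  | 0 => rfl
  | n + 1 => by
    rw [gaussBinom, gaussBinom_self q n, gaussBinom_of_lt q n (n + 1) (by omega)]
    simp

theorem gaussBinom_absorb (q : k) (n : ℕ) : ∀ i : ℕ,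
    (∑ j ∈ Finset.range (i + 1), q ^ j) * gaussBinom q (n + 1) (i + 1) =
      (∑ j ∈ Finset.range (n + 1), q ^ j) * gaussBinom q n i := by
  induction n with
  | zero =>
    intro i
    cases i with
    | zero => simp [gaussBinom]
    | succ i => simp [gaussBinom]
  | succ n ih =>
    intro i
    have hs : ∀ m : ℕ, ∑ j ∈ Finset.range (m + 1), q ^ j =
        1 + q * ∑ j ∈ Finset.range m, q ^ j := by
      intro m
      rw [Finset.sum_range_succ', Finset.mul_sum, add_comm]
      simp [pow_succ, mul_comm]
    rw [gaussBinom, mul_add, mul_left_comm, ih i]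
    cases i with
    | zero =>
      rw [gaussBinom_zero, gaussBinom_zero, hs (n + 1)]
      simp
    | succ i =>
      have h1 := ih i
      have h2 : gaussBinom q (n + 1) (i + 1) =
        gaussBinom q n i + q ^ (i + 1) * gaussBinom q n (i + 1) := rfl
      rw [hs (n + 1), hs (i + 1)]
      linear_combination q * h1 - q * (∑ j ∈ Finset.range (n + 1), q ^ j) * h2

theorem add_pow_of_qcomm {B : Type*} [Ring B] [Algebra k B] (q : k) {x y : B}
    (h : y * x = q • (x * y)) (n : ℕ) :
    (x + y) ^ n = ∑ i ∈ Finset.range (n + 1), gaussBinom q n i • (x ^ i * y ^ (n - i)) := by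
  have hy : ∀ i : ℕ, y * x ^ i = q ^ i • (x ^ i * y) := by
    intro i
    induction i with
    | zero => simp
    | succ i ih =>
      rw [pow_succ, ← mul_assoc, ih, smul_mul_assoc, mul_assoc, h, mul_smul_comm, smul_smul,
        mul_assoc, pow_succ]
  induction n with
  | zero => simp [gaussBinom]
  | succ n ih =>
    rw [pow_succ', ih, add_mul, Finset.mul_sum, Finset.mul_sum, Finset.sum_range_succ' _ (n + 1)]
    have e1 : ∀ i ∈ Finset.range (n + 1),
        gaussBinom q (n + 1) (i + 1) • (x ^ (i + 1) * y ^ (n + 1 - (i + 1))) =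
        x * (gaussBinom q n i • (x ^ i * y ^ (n - i))) +
        (q ^ (i + 1) * gaussBinom q n (i + 1)) • (x ^ (i + 1) * y ^ (n - i)) := by
      intro i _
      rw [gaussBinom, add_smul, Nat.add_sub_add_right, mul_smul_comm, pow_succ', mul_assoc]
    have e2 : ∀ i ∈ Finset.range (n + 1),
        y * (gaussBinom q n i • (x ^ i * y ^ (n - i))) =
        (q ^ i * gaussBinom q n i) • (x ^ i * y ^ (n + 1 - i)) := by
      intro i hi
      have hi' : n + 1 - i = (n - i) + 1 := by
        have := Finset.mem_range.1 hi
        omega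
      rw [mul_smul_comm, ← mul_assoc, hy, smul_mul_assoc, smul_smul, mul_assoc, ← pow_succ', hi',
        mul_comm]
    rw [Finset.sum_congr rfl e1, Finset.sum_congr rfl e2, Finset.sum_add_distrib, add_assoc]
    congr 1
    rw [Finset.sum_range_succ' _ n, Finset.sum_range_succ,
      gaussBinom_of_lt q n (n + 1) (by omega)]
    simp [gaussBinom_zero]

theorem add_pow_of_primitiveRoot {B : Type*} [Ring B] [Algebra k B] (q : k) {l : ℕ} (hl : 2 ≤ l)
    (hq : IsPrimitiveRoot q l) {x y : B} (h : y * x = q • (x * y)) :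
    (x + y) ^ l = x ^ l + y ^ l := by
  obtain ⟨n, rfl⟩ : ∃ n, l = n + 1 := ⟨l - 1, by omega⟩
  rw [add_pow_of_qcomm q h, Finset.sum_range_succ, Finset.sum_range_succ', gaussBinom_self,
    gaussBinom_zero, Finset.sum_eq_zero]
  · simp [add_comm]
  · intro i hi
    have hi' := Finset.mem_range.1 hi
    have hq1 : q ≠ 1 := hq.ne_one (by omega)
    have h1 := gaussBinom_absorb q n i
    rw [geom_sum_eq hq1, geom_sum_eq hq1, hq.pow_eq_one, sub_self, zero_div, zero_mul] at h1
    have h2 : q ^ (i + 1) - 1 ≠ 0 :=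
      sub_ne_zero.2 (hq.pow_ne_one_of_pos_of_lt (by omega) (by omega))
    rcases mul_eq_zero.1 h1 with h3 | h3
    · exact absurd h3 (div_ne_zero h2 (sub_ne_zero.2 hq1))
    · rw [h3, zero_smul]

end QBinomial

/-! ### The Hopf algebra `H_q` -/

/-- Names of the generators of `H_q`; `σinv` is the inverse of `σ`. -/
inductive HqGen : Type
  | D₁
  | D₂
  | σ
  | σinv

/-- The defining relations of `H_q`. The last two occur only if `q` is a primitive `l`-th root
of unity with `2 ≤ l`. -/
inductive HqRel (k : Type*) [Field k] (q : kˣ) :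
    FreeAlgebra k HqGen → FreeAlgebra k HqGen → Prop
  | D_comm : HqRel k q (FreeAlgebra.ι k HqGen.D₁ * FreeAlgebra.ι k HqGen.D₂)
      (FreeAlgebra.ι k HqGen.D₂ * FreeAlgebra.ι k HqGen.D₁)
  | σ_inv : HqRel k q (FreeAlgebra.ι k HqGen.σ * FreeAlgebra.ι k HqGen.σinv) 1
  | inv_σ : HqRel k q (FreeAlgebra.ι k HqGen.σinv * FreeAlgebra.ι k HqGen.σ) 1
  | σ_D₁ : HqRel k q ((q : k) • (FreeAlgebra.ι k HqGen.σ * FreeAlgebra.ι k HqGen.D₁))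
      (FreeAlgebra.ι k HqGen.D₁ * FreeAlgebra.ι k HqGen.σ)
  | σ_D₂ : HqRel k q ((q : k) • (FreeAlgebra.ι k HqGen.σ * FreeAlgebra.ι k HqGen.D₂))
      (FreeAlgebra.ι k HqGen.D₂ * FreeAlgebra.ι k HqGen.σ)
  | D₁_pow (l : ℕ) (hl : 2 ≤ l) (hq : IsPrimitiveRoot (q : k) l) :
      HqRel k q (FreeAlgebra.ι k HqGen.D₁ ^ l) 0
  | D₂_pow (l : ℕ) (hl : 2 ≤ l) (hq : IsPrimitiveRoot (q : k) l) :
      HqRel k q (FreeAlgebra.ι k HqGen.D₂ ^ l) 0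

/-- The algebra `H_q`. -/
def Hq (k : Type*) [Field k] (q : kˣ) : Type _ := RingQuot (HqRel k q)

namespace Hq

variable {k : Type*} [Field k] (q : kˣ)

instance : Ring (Hq k q) := inferInstanceAs (Ring (RingQuot (HqRel k q)))

instance : Algebra k (Hq k q) := inferInstanceAs (Algebra k (RingQuot (HqRel k q)))

/-- The class of a generator in `H_q`. -/
def gen (x : HqGen) : Hq k q := RingQuot.mkAlgHom k (HqRel k q) (FreeAlgebra.ι k x)

/-- The generator `D₁` of `H_q`. -/
abbrev D₁ : Hq k q := gen q HqGen.D₁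

/-- The generator `D₂` of `H_q`. -/
abbrev D₂ : Hq k q := gen q HqGen.D₂

/-- The generator `σ` of `H_q`. -/
abbrev σ : Hq k q := gen q HqGen.σ

/-- The generator `σ⁻¹` of `H_q`. -/
abbrev σinv : Hq k q := gen q HqGen.σinv

theorem D_comm : D₁ q * D₂ q = D₂ q * D₁ q := by
  have h := RingQuot.mkAlgHom_rel k (HqRel.D_comm (k := k) (q := q))
  rw [map_mul, map_mul] at h
  exact h

theorem σ_inv : σ q * σinv q = 1 := by
  have h := RingQuot.mkAlgHom_rel k (HqRel.σ_inv (k := k) (q := q))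
  rw [map_mul, map_one] at h
  exact h

theorem inv_σ : σinv q * σ q = 1 := by
  have h := RingQuot.mkAlgHom_rel k (HqRel.inv_σ (k := k) (q := q))
  rw [map_mul, map_one] at h
  exact h

theorem D₁_σ : D₁ q * σ q = (q : k) • (σ q * D₁ q) := by
  have h := RingQuot.mkAlgHom_rel k (HqRel.σ_D₁ (k := k) (q := q))
  rw [map_smul, map_mul, map_mul] at h
  exact h.symm

theorem D₂_σ : D₂ q * σ q = (q : k) • (σ q * D₂ q) := by
  have h := RingQuot.mkAlgHom_rel k (HqRel.σ_D₂ (k := k) (q := q))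
  rw [map_smul, map_mul, map_mul] at h
  exact h.symm

theorem D₁_pow {l : ℕ} (hl : 2 ≤ l) (hq : IsPrimitiveRoot (q : k) l) : D₁ q ^ l = 0 := by
  have h := RingQuot.mkAlgHom_rel k (HqRel.D₁_pow (k := k) (q := q) l hl hq)
  rw [map_pow, map_zero] at h
  exact h

theorem D₂_pow {l : ℕ} (hl : 2 ≤ l) (hq : IsPrimitiveRoot (q : k) l) : D₂ q ^ l = 0 := by
  have h := RingQuot.mkAlgHom_rel k (HqRel.D₂_pow (k := k) (q := q) l hl hq)
  rw [map_pow, map_zero] at h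
  exact h

variable {B : Type*} [Ring B] [Algebra k B]

/-- The universal property of `H_q`. -/
def lift (x : HqGen → B) (h1 : x .D₁ * x .D₂ = x .D₂ * x .D₁) (h2 : x .σ * x .σinv = 1)
    (h3 : x .σinv * x .σ = 1) (h4 : x .D₁ * x .σ = (q : k) • (x .σ * x .D₁))
    (h5 : x .D₂ * x .σ = (q : k) • (x .σ * x .D₂))
    (h6 : ∀ l : ℕ, 2 ≤ l → IsPrimitiveRoot (q : k) l → x .D₁ ^ l = 0)
    (h7 : ∀ l : ℕ, 2 ≤ l → IsPrimitiveRoot (q : k) l → x .D₂ ^ l = 0) : Hq k q →ₐ[k] B :=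
  RingQuot.liftAlgHom k ⟨FreeAlgebra.lift k x, by
    intro a b hab
    cases hab with
    | D_comm => simpa using h1
    | σ_inv => simpa using h2
    | inv_σ => simpa using h3
    | σ_D₁ => simpa using h4.symm
    | σ_D₂ => simpa using h5.symm
    | D₁_pow l hl hq => simpa using h6 l hl hq
    | D₂_pow l hl hq => simpa using h7 l hl hq⟩

theorem lift_gen (x : HqGen → B) (h1 h2 h3 h4 h5 h6 h7) (y : HqGen) :
    lift q x h1 h2 h3 h4 h5 h6 h7 (gen q y) = x y := by
  have h := RingQuot.liftAlgHom_mkAlgHom_apply k (FreeAlgebra.lift k x)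
    (s := HqRel k q) (fun a b hab => by
      cases hab with
      | D_comm => simpa using h1
      | σ_inv => simpa using h2
      | inv_σ => simpa using h3
      | σ_D₁ => simpa using h4.symm
      | σ_D₂ => simpa using h5.symm
      | D₁_pow l hl hq => simpa using h6 l hl hq
      | D₂_pow l hl hq => simpa using h7 l hl hq) (FreeAlgebra.ι k y)
  exact h.trans (FreeAlgebra.lift_ι_apply ..)

theorem algHom_ext' {F F' : Hq k q →ₐ[k] B} (h : ∀ y, F (gen q y) = F' (gen q y)) : F = F' := by
  have : F.comp (RingQuot.mkAlgHom k (HqRel k q)) = F'.comp (RingQuot.mkAlgHom k (HqRel k q)) :=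
    FreeAlgebra.hom_ext (funext h)
  exact RingQuot.ringQuot_ext' _ _ _ this

/-- The comultiplication on generators:
`D₁ ↦ D₁ ⊗ σ + 1 ⊗ D₁`, `D₂ ↦ D₂ ⊗ 1 + σ ⊗ D₂`, `σ^{±1} ↦ σ^{±1} ⊗ σ^{±1}`. -/
def comulGen : HqGen → Hq k q ⊗[k] Hq k q
  | .D₁ => D₁ q ⊗ₜ σ q + 1 ⊗ₜ D₁ q
  | .D₂ => D₂ q ⊗ₜ 1 + σ q ⊗ₜ D₂ q
  | .σ => σ q ⊗ₜ σ q
  | .σinv => σinv q ⊗ₜ σinv q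

/-- The comultiplication of `H_q`, as an algebra homomorphism. -/
def comulHom : Hq k q →ₐ[k] Hq k q ⊗[k] Hq k q :=
  lift q (comulGen q)
    (by
      simp only [comulGen, mul_add, add_mul, Algebra.TensorProduct.tmul_mul_tmul, mul_one, one_mul,
        D_comm, D₁_σ, D₂_σ, TensorProduct.tmul_smul, ← TensorProduct.smul_tmul']
      abel)
    (by simp [comulGen, σ_inv, Algebra.TensorProduct.one_def])
    (by simp [comulGen, inv_σ, Algebra.TensorProduct.one_def])
    (by simp [comulGen, mul_add, add_mul, D₁_σ, TensorProduct.tmul_smul,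
      TensorProduct.smul_tmul'])
    (by simp [comulGen, mul_add, add_mul, D₂_σ, TensorProduct.tmul_smul,
      TensorProduct.smul_tmul'])
    (by
      intro l hl hq
      rw [comulGen, add_pow_of_primitiveRoot (q : k) hl hq]
      · rw [Algebra.TensorProduct.tmul_pow, Algebra.TensorProduct.tmul_pow, D₁_pow q hl hq]
        simp
      · simp [D₁_σ, TensorProduct.tmul_smul])
    (by
      intro l hl hq
      rw [comulGen, add_comm, add_pow_of_primitiveRoot (q : k) hl hq]
      · rw [Algebra.TensorProduct.tmul_pow, Algebra.TensorProduct.tmul_pow, D₂_pow q hl hq]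
        simp
      · simp [D₂_σ, TensorProduct.smul_tmul'])

/-- The counit on generators: `D₁, D₂ ↦ 0` and `σ^{±1} ↦ 1`. -/
def counitGen : HqGen → k
  | .D₁ => 0
  | .D₂ => 0
  | .σ => 1
  | .σinv => 1

/-- The counit of `H_q`, as an algebra homomorphism. -/
def counitHom : Hq k q →ₐ[k] k :=
  lift q counitGen (by simp [counitGen]) (by simp [counitGen]) (by simp [counitGen])
    (by simp [counitGen]) (by simp [counitGen])
    (fun l hl _ => by simp [counitGen]; omega) (fun l hl _ => by simp [counitGen]; omega)

theorem comulHom_gen (y : HqGen) : comulHom q (gen q y) = comulGen q y := lift_gen ..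

theorem counitHom_gen (y : HqGen) : counitHom q (gen q y) = counitGen y := lift_gen ..

instance : Bialgebra k (Hq k q) :=
  Bialgebra.ofAlgHom (comulHom q) (counitHom q)
    (by
      apply algHom_ext'
      intro y
      cases y <;>
        simp [comulHom_gen, comulGen, Algebra.TensorProduct.one_def, TensorProduct.tmul_add,
          TensorProduct.add_tmul, add_assoc])
    (by
      apply algHom_ext'
      intro y
      cases y <;>
        simp [comulHom_gen, counitHom_gen, comulGen, counitGen])
    (by
      apply algHom_ext'
      intro y
      cases y <;>
        simp [comulHom_gen, counitHom_gen, comulGen, counitGen])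

end Hq

/-! ### The good transposition attached to an automorphism -/

section Good

variable {k A : Type*} [Field k] (q : kˣ) [Ring A] [Algebra k A] (α : A ≃ₐ[k] A)

/-- The powers of `α` which the generators of `H_q` carry along:
`α` for `D₁`, `α⁻¹` for `D₂` and the identity for `σ^{±1}`. -/
def slideGen : HqGen → Module.End k A
  | .D₁ => α.toLinearMap
  | .D₂ => α.symm.toLinearMap
  | .σ => 1
  | .σinv => 1

/-- The algebra homomorphism `H_q → End(A) ⊗ H_q` sending `σ^i D₁^j D₂^m` to
`α^{j-m} ⊗ σ^i D₁^j D₂^m`. -/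
def slideHom : Hq k q →ₐ[k] Module.End k A ⊗[k] Hq k q :=
  Hq.lift q (fun y => slideGen α y ⊗ₜ[k] Hq.gen q y)
    (by
      have h1 : α.toLinearMap * α.symm.toLinearMap = 1 := by
        ext a
        simp
      have h2 : α.symm.toLinearMap * α.toLinearMap = 1 := by
        ext a
        simp
      simp only [slideGen, Algebra.TensorProduct.tmul_mul_tmul, h1, h2, Hq.D_comm])
    (by simp [slideGen, Hq.σ_inv, Algebra.TensorProduct.one_def])
    (by simp [slideGen, Hq.inv_σ, Algebra.TensorProduct.one_def])
    (by simp [slideGen, Hq.D₁_σ])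
    (by simp [slideGen, Hq.D₂_σ])
    (fun l hl hq => by rw [Algebra.TensorProduct.tmul_pow, Hq.D₁_pow q hl hq]; simp)
    (fun l hl hq => by rw [Algebra.TensorProduct.tmul_pow, Hq.D₂_pow q hl hq]; simp)

/-- The good transposition of `H_q` on `A` attached to the automorphism `α`, that is
`σ^i D₁^j D₂^m ⊗ a ↦ α^{j-m}(a) ⊗ σ^i D₁^j D₂^m`. -/
def goodTransposition : Hq k q ⊗[k] A →ₗ[k] A ⊗[k] Hq k q :=
  TensorProduct.lift
    ((LinearMap.rTensorHom (R := k) (Hq k q) ∘ₗ LinearMap.applyₗ).flip ∘ₗ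
      (slideHom q α).toLinearMap)

theorem goodTransposition_gen (y : HqGen) (a : A) :
    goodTransposition q α (Hq.gen q y ⊗ₜ a) = slideGen α y a ⊗ₜ Hq.gen q y := by
  have h : slideHom q α (Hq.gen q y) = slideGen α y ⊗ₜ Hq.gen q y := Hq.lift_gen ..
  simp [goodTransposition, h]

/-- The characteristic property of a good transposition. -/
theorem goodTransposition_good (a : A) :
    slideTwo (goodTransposition q α) (Hq.D₁ q ⊗ₜ (Hq.D₂ q ⊗ₜ a)) =
      a ⊗ₜ (Hq.D₁ q ⊗ₜ Hq.D₂ q) := by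
  simp [slideTwo, goodTransposition_gen, slideGen]

end Good

/-! ### Crossed products `S(V) #_f G` -/

/-- A normal (that is, normalized) 2-cocycle `G × G → kˣ` (trivial action on `kˣ`). -/
structure NormalCocycle (k G : Type*) [Field k] [Group G] where
  /-- the underlying function -/
  toFun : G → G → kˣ
  cocycle : ∀ g h l : G, toFun g h * toFun (g * h) l = toFun h l * toFun g (h * l)
  one_left : ∀ g : G, toFun 1 g = 1
  one_right : ∀ g : G, toFun g 1 = 1

section SymMap

variable {k V : Type*} [Field k] [AddCommGroup V] [Module k V]

/-- The algebra endomorphism of `S(V)` that extends a linear endomorphism of `V`. -/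
def symMap (φ : V →ₗ[k] V) : SymmetricAlgebra k V →ₐ[k] SymmetricAlgebra k V :=
  SymmetricAlgebra.lift (SymmetricAlgebra.ι k V ∘ₗ φ)

theorem symMap_ι (φ : V →ₗ[k] V) (v : V) :
    symMap φ (SymmetricAlgebra.ι k V v) = SymmetricAlgebra.ι k V (φ v) := by
  simp [symMap]

theorem symMap_comp (φ ψ : V →ₗ[k] V) (P : SymmetricAlgebra k V) :
    symMap φ (symMap ψ P) = symMap (φ ∘ₗ ψ) P := by
  have h : (symMap φ).comp (symMap ψ) = symMap (φ ∘ₗ ψ) := by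
    apply SymmetricAlgebra.algHom_ext
    ext v
    simp [symMap_ι]
  exact DFunLike.congr_fun h P

theorem symMap_id (P : SymmetricAlgebra k V) : symMap LinearMap.id P = P := by
  have h : symMap (LinearMap.id : V →ₗ[k] V) = AlgHom.id k _ := by
    apply SymmetricAlgebra.algHom_ext
    ext v
    simp [symMap_ι]
  exact DFunLike.congr_fun h P

end SymMap

variable {k G V : Type*} [Field k] [Group G] [AddCommGroup V] [Module k V]

/-- The crossed product `S(V) #_f G`: finite sums of terms `P w_g`, where
`P ∈ S(V)` and `g ∈ G`, the term `P w_g` being `Finsupp.single g P`. -/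
def CrossedProduct (_π : Representation k G V) (_f : NormalCocycle k G) : Type _ :=
  G →₀ SymmetricAlgebra k V

namespace CrossedProduct

variable (π : Representation k G V) (f : NormalCocycle k G)

instance : AddCommGroup (CrossedProduct π f) :=
  inferInstanceAs (AddCommGroup (G →₀ SymmetricAlgebra k V))

instance : Module k (CrossedProduct π f) :=
  inferInstanceAs (Module k (G →₀ SymmetricAlgebra k V))

/-- The element `P w_g`. -/
def term (g : G) : SymmetricAlgebra k V →ₗ[k] CrossedProduct π f := Finsupp.lsingle g

variable {π f} in
theorem hom_ext {M : Type*} [AddCommGroup M] [Module k M] {φ ψ : CrossedProduct π f →ₗ[k] M}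
    (h : ∀ g P, φ (term π f g P) = ψ (term π f g P)) : φ = ψ :=
  Finsupp.lhom_ext h

/-- The linear map out of the crossed product with prescribed values on the terms `P w_g`. -/
def ofTerms {M : Type*} [AddCommGroup M] [Module k M]
    (φ : G → SymmetricAlgebra k V →ₗ[k] M) : CrossedProduct π f →ₗ[k] M :=
  Finsupp.lsum k φ

@[simp]
theorem ofTerms_term {M : Type*} [AddCommGroup M] [Module k M]
    (φ : G → SymmetricAlgebra k V →ₗ[k] M) (g : G) (P : SymmetricAlgebra k V) :
    ofTerms π f φ (term π f g P) = φ g P := by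
  simp only [ofTerms, term]
  exact Finsupp.lsum_single k φ g P

/-- The multiplication `(P w_g) (Q w_h) = f(g,h) P (ᵍQ) w_{gh}`. -/
def mulMap : CrossedProduct π f →ₗ[k] CrossedProduct π f →ₗ[k] CrossedProduct π f :=
  ofTerms π f fun g => LinearMap.flip (ofTerms π f fun h => LinearMap.flip
    (((LinearMap.mul k (SymmetricAlgebra k V)).compl₂ (symMap (π g)).toLinearMap).compr₂
      ((f.toFun g h : k) • term π f (g * h))))

@[simp]
theorem mulMap_term (g h : G) (P Q : SymmetricAlgebra k V) :
    mulMap π f (term π f g P) (term π f h Q) =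
      term π f (g * h) ((f.toFun g h : k) • (P * symMap (π g) Q)) := by
  simp [mulMap]

@[elab_as_elim]
theorem induction_terms {p : CrossedProduct π f → Prop} (a : CrossedProduct π f) (h0 : p 0)
    (hadd : ∀ a b, p a → p b → p (a + b)) (hterm : ∀ g P, p (term π f g P)) : p a :=
  Finsupp.induction_linear (motive := p) a h0 hadd hterm

theorem mulMap_assoc (a b c : CrossedProduct π f) :
    mulMap π f (mulMap π f a b) c = mulMap π f a (mulMap π f b c) := by
  induction a using induction_terms with
  | h0 => simp
  | hadd a₁ a₂ h₁ h₂ => simp [h₁, h₂]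
  | hterm g P =>
    induction b using induction_terms with
    | h0 => simp
    | hadd b₁ b₂ h₁ h₂ => simp [h₁, h₂]
    | hterm h Q =>
      induction c using induction_terms with
      | h0 => simp
      | hadd c₁ c₂ h₁ h₂ => simp only [map_add, h₁, h₂]
      | hterm l R =>
        have hc : (f.toFun g h : k) * (f.toFun (g * h) l : k) =
            (f.toFun h l : k) * (f.toFun g (h * l) : k) := by
          exact_mod_cast congrArg Units.val (f.cocycle g h l)
        have hR : symMap (π g * π h) R = symMap (π g) (symMap (π h) R) := by
          rw [symMap_comp]
          rfl
        simp only [mulMap_term, mul_assoc g h l, map_smul, LinearMap.smul_apply, map_mul, hR,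
          smul_smul, hc, mul_assoc P]

instance : Mul (CrossedProduct π f) := ⟨fun a b => mulMap π f a b⟩

instance : One (CrossedProduct π f) := ⟨term π f 1 1⟩

theorem mul_def (a b : CrossedProduct π f) : a * b = mulMap π f a b := rfl

theorem one_def : (1 : CrossedProduct π f) = term π f 1 1 := rfl

theorem term_mul_term (g h : G) (P Q : SymmetricAlgebra k V) :
    term π f g P * term π f h Q =
      term π f (g * h) ((f.toFun g h : k) • (P * symMap (π g) Q)) :=
  mulMap_term π f g h P Q

theorem symMap_one (P : SymmetricAlgebra k V) : symMap (π 1) P = P := by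
  rw [map_one]
  exact symMap_id P

instance : Ring (CrossedProduct π f) :=
  { (inferInstance : AddCommGroup (CrossedProduct π f)) with
    mul := (· * ·)
    one := 1
    left_distrib := fun a b c => by simp [mul_def]
    right_distrib := fun a b c => by simp [mul_def]
    zero_mul := fun a => by simp [mul_def]
    mul_zero := fun a => by simp [mul_def]
    mul_assoc := mulMap_assoc π f
    one_mul := fun a => by
      rw [mul_def, one_def]
      induction a using induction_terms with
      | h0 => simp
      | hadd a₁ a₂ h₁ h₂ => simp [h₁, h₂]
      | hterm g P => simp [f.one_left, symMap_id, Module.End.one_eq_id]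
    mul_one := fun a => by
      rw [mul_def, one_def]
      induction a using induction_terms with
      | h0 => simp
      | hadd a₁ a₂ h₁ h₂ => simp [h₁, h₂]
      | hterm g P => simp [f.one_right] }

instance : Algebra k (CrossedProduct π f) :=
  Algebra.ofModule (fun r a b => by simp [mul_def]) (fun r a b => by simp [mul_def])

/-- The inclusion of `S(V)`, `P ↦ P w_1`. -/
def incl : SymmetricAlgebra k V →ₐ[k] CrossedProduct π f :=
  AlgHom.ofLinearMap (term π f 1) rfl (fun P Q => by
    simp [term_mul_term, f.one_left, symMap_id, Module.End.one_eq_id])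

/-- The inclusion of `V` in `S(V) #_f G`. -/
def ofV : V →ₗ[k] CrossedProduct π f :=
  (incl π f).toLinearMap ∘ₗ SymmetricAlgebra.ι k V

/-- The basis element `w_g`. -/
def w (g : G) : CrossedProduct π f := term π f g 1

theorem incl_mul_w (P : SymmetricAlgebra k V) (g : G) :
    incl π f P * w π f g = term π f g P := by
  change term π f 1 P * term π f g 1 = _
  simp [term_mul_term, f.one_left]

/-- The linear map `v_1 ⋯ v_m w_g ↦ φ(v_1) ⋯ φ(v_m) χ(g) w_g`. -/
def diag (φ : V →ₗ[k] V) (χ : G → kˣ) : CrossedProduct π f →ₗ[k] CrossedProduct π f :=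
  ofTerms π f fun g => (χ g : k) • (term π f g ∘ₗ (symMap φ).toLinearMap)

@[simp]
theorem diag_term (φ : V →ₗ[k] V) (χ : G → kˣ) (g : G) (P : SymmetricAlgebra k V) :
    diag π f φ χ (term π f g P) = (χ g : k) • term π f g (symMap φ P) := by
  simp [diag]

theorem diag_apply (φ : V →ₗ[k] V) (χ : G → kˣ) {m : ℕ} (v : Fin m → V) (g : G) :
    diag π f φ χ (incl π f (∏ i, SymmetricAlgebra.ι k V (v i)) * w π f g) =
      incl π f (∏ i, SymmetricAlgebra.ι k V (φ (v i))) * ((χ g : k) • w π f g) := by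
  simp only [mul_smul_comm, incl_mul_w, diag_term, map_prod, symMap_ι]

/-- The automorphism of `S(V) #_f G` determined by a bijective `k[G]`-linear map `φ` of `V` and a
character `χ` of `G`: it sends `v_1 ⋯ v_m w_g` to `φ(v_1) ⋯ φ(v_m) χ(g) w_g`. -/
def diagEquiv (φ : V ≃ₗ[k] V) (hφ : ∀ g v, φ (π g v) = π g (φ v)) (χ : G →* kˣ) :
    CrossedProduct π f ≃ₐ[k] CrossedProduct π f :=
  AlgEquiv.ofLinearEquiv
    (LinearEquiv.ofLinearMap (diag π f φ.toLinearMap χ) (diag π f φ.symm.toLinearMap (χ⁻¹ : G →* kˣ))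
      (by
        apply hom_ext
        intro g P
        simp [symMap_comp, symMap_id, smul_smul])
      (by
        apply hom_ext
        intro g P
        simp [symMap_comp, symMap_id, smul_smul]))
    (by simp [one_def])
    (fun a b => by
      have hs : ∀ g Q, symMap φ.toLinearMap (symMap (π g) Q) =
          symMap (π g) (symMap φ.toLinearMap Q) := by
        intro g Q
        rw [symMap_comp, symMap_comp]
        congr 2
        ext v
        exact hφ g v
      simp only [LinearEquiv.coe_ofLinearMap]
      induction a using induction_terms with
      | h0 => simp
      | hadd a₁ a₂ h₁ h₂ => simp only [add_mul, map_add, h₁, h₂]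
      | hterm g P =>
        induction b using induction_terms with
        | h0 => simp
        | hadd b₁ b₂ h₁ h₂ => simp only [mul_add, map_add, h₁, h₂]
        | hterm h Q =>
          simp only [term_mul_term, diag_term, map_smul, map_mul, hs, smul_mul_assoc,
            mul_smul_comm, smul_smul, Units.val_mul]
          congr 1
          ring)

theorem diagEquiv_apply (φ : V ≃ₗ[k] V) (hφ : ∀ g v, φ (π g v) = π g (φ v)) (χ : G →* kˣ)
    (a : CrossedProduct π f) :
    diagEquiv π f φ hφ χ a = diag π f φ.toLinearMap χ a := rfl

/-! ### Skew derivations of the crossed product -/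

/-- The symmetry condition under which a map `d : V → A` extends to a skew derivation along
`a` (on the left) and `b` (on the right). -/
def SkewSymm (a b : V →ₗ[k] V) (d : V →ₗ[k] CrossedProduct π f) : Prop :=
  ∀ v w : V, d v * ofV π f (b w) + ofV π f (a v) * d w =
    d w * ofV π f (b v) + ofV π f (a w) * d v

section Skew

variable {π f}
variable {a b : V →ₗ[k] V} {d : V →ₗ[k] CrossedProduct π f} (h : SkewSymm π f a b d)

/-- `v ↦ [[a v, d v], [0, b v]]`. -/
def skewMatrix (a b : V →ₗ[k] V) (d : V →ₗ[k] CrossedProduct π f) :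
    V →ₗ[k] Matrix (Fin 2) (Fin 2) (CrossedProduct π f) where
  toFun v := !![ofV π f (a v), d v; 0, ofV π f (b v)]
  map_add' v v' := by
    ext i j
    fin_cases i <;> fin_cases j <;> simp
  map_smul' r v := by
    ext i j
    fin_cases i <;> fin_cases j <;> simp

theorem ofV_comm (v v' : V) : ofV π f v * ofV π f v' = ofV π f v' * ofV π f v := by
  simp only [ofV, LinearMap.comp_apply, AlgHom.toLinearMap_apply, ← map_mul, mul_comm]

theorem skewMatrix_comm (h : SkewSymm π f a b d) (v v' : V) :
    skewMatrix a b d v * skewMatrix a b d v' = skewMatrix a b d v' * skewMatrix a b d v := by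
  have h1 := h v v'
  ext i j
  fin_cases i <;> fin_cases j <;>
    simp [skewMatrix, Matrix.mul_apply, Fin.sum_univ_two, ofV_comm (f := f) (a v),
      ofV_comm (f := f) (b v)]
  rw [add_comm, h1, add_comm]

/-- The algebra homomorphism from `S(V)` to the 2 by 2 matrices extending `skewMatrix`. -/
def skewHom : SymmetricAlgebra k V →ₐ[k] Matrix (Fin 2) (Fin 2) (CrossedProduct π f) :=
  RingCon.liftₐ _ (TensorAlgebra.lift k (skewMatrix a b d)) (by
    refine RingCon.ringConGen_le.2 fun x y hxy => ?_
    induction hxy with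
    | mul_comm x y =>
      rw [RingCon.ker_apply]
      simpa using skewMatrix_comm h x y)

theorem skewHom_ι (v : V) :
    skewHom h (SymmetricAlgebra.ι k V v) = skewMatrix a b d v :=
  TensorAlgebra.lift_ι_apply (skewMatrix a b d) v

theorem skewHom_diag (P : SymmetricAlgebra k V) :
    skewHom h P 0 0 = incl π f (symMap a P) ∧ skewHom h P 1 0 = 0 ∧
      skewHom h P 1 1 = incl π f (symMap b P) := by
  induction P using SymmetricAlgebra.induction with
  | algebraMap r => simp [Matrix.algebraMap_eq_diagonal]
  | ι v => simp [skewHom_ι, skewMatrix, symMap_ι, ofV]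
  | mul P Q hP hQ =>
    simp [Matrix.mul_apply, Fin.sum_univ_two, hP.1, hP.2.1, hP.2.2, hQ.1, hQ.2.1, hQ.2.2]
  | add P Q hP hQ => simp [hP.1, hP.2.1, hP.2.2, hQ.1, hQ.2.1, hQ.2.2]

theorem skewHom_prod {m : ℕ} (v : Fin m → V) :
    skewHom h (∏ i, SymmetricAlgebra.ι k V (v i)) 0 1 =
      ∑ j, incl π f (∏ i ∈ Finset.Iio j, SymmetricAlgebra.ι k V (a (v i))) * d (v j) *
        incl π f (∏ i ∈ Finset.Ioi j, SymmetricAlgebra.ι k V (b (v i))) := by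
  induction m with
  | zero => simp
  | succ m ih =>
    have e : ∀ (j : Fin m) (x : Fin (m + 1) → SymmetricAlgebra k V),
        ∏ i ∈ Finset.Iio j.succ, x i = x 0 * ∏ i ∈ Finset.Iio j, x i.succ := by
      intro j x
      have e1 : Finset.Iio j.succ = Finset.univ.filter (· < j.succ) := by
        ext i
        simp
      have e2 : Finset.Iio j = Finset.univ.filter (· < j) := by
        ext i
        simp
      rw [e1, e2, Finset.prod_filter, Finset.prod_filter, Fin.prod_univ_succ]
      simp
    have e0 : Finset.Iio (0 : Fin (m + 1)) = ∅ := by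
      ext i
      simp
    rw [Fin.prod_univ_succ, map_mul, Matrix.mul_apply, Fin.sum_univ_two,
      ih (fun i => v i.succ), (skewHom_diag h _).1, (skewHom_diag h _).2.2, Fin.sum_univ_succ,
      skewHom_ι, add_comm]
    simp only [e, e0, Fin.prod_Ioi_zero, Fin.prod_Ioi_succ, map_mul, Finset.prod_empty, map_one,
      one_mul, map_prod, symMap_ι, Finset.mul_sum, mul_assoc]
    simp [skewMatrix]

/-- The linear map `δ` on `S(V) #_f G` attached to maps `a, b : V → V`, `χ : G → kˣ`,
`d : V → A` and `e : G → A` with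
`δ(v_1 ⋯ v_m w_g) = ∑_j a(v_1) ⋯ a(v_{j-1}) d(v_j) b(v_{j+1}) ⋯ b(v_m) χ(g) w_g
  + a(v_1) ⋯ a(v_m) e(g)`, see `skewDer_apply`. -/
def skewDer (χ : G → kˣ) (e : G → CrossedProduct π f) :
    CrossedProduct π f →ₗ[k] CrossedProduct π f :=
  ofTerms π f fun g =>
    LinearMap.mulRight k ((χ g : k) • w π f g) ∘ₗ
        Matrix.entryLinearMap k (CrossedProduct π f) (0 : Fin 2) (1 : Fin 2) ∘ₗ
          (skewHom h).toLinearMap +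
      LinearMap.mulRight k (e g) ∘ₗ (incl π f).toLinearMap ∘ₗ (symMap a).toLinearMap

theorem skewDer_apply (χ : G → kˣ) (e : G → CrossedProduct π f) {m : ℕ} (v : Fin m → V) (g : G) :
    skewDer h χ e (incl π f (∏ i, SymmetricAlgebra.ι k V (v i)) * w π f g) =
      ∑ j, incl π f (∏ i ∈ Finset.Iio j, SymmetricAlgebra.ι k V (a (v i))) * d (v j) *
          (incl π f (∏ i ∈ Finset.Ioi j, SymmetricAlgebra.ι k V (b (v i))) *
            ((χ g : k) • w π f g)) +
        incl π f (∏ i, SymmetricAlgebra.ι k V (a (v i))) * e g := by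
  rw [incl_mul_w, skewDer, ofTerms_term]
  simp only [LinearMap.add_apply, LinearMap.comp_apply, AlgHom.toLinearMap_apply,
    Matrix.entryLinearMap_apply, LinearMap.mulRight_apply, skewHom_prod, map_prod (symMap a),
    symMap_ι, Finset.sum_mul, mul_assoc]

end Skew

end CrossedProduct

end HqMod

end

open HqMod HqMod.CrossedProduct

noncomputable section

/-! An action of `H_q` amounts to three operators on `A`: `σ` acts by an invertible `S`, and `D₁`,
`D₂` act by `d₁`, `d₂`, subject to the relations of `H_q`. For the good transposition, the module
algebra axioms then say that `S` is an algebra automorphism, that `d₁(ab) = d₁(a)S(b) + α(a)d₁(b)`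
and `d₂(ab) = d₂(a)b + S(α⁻¹(a))d₂(b)`, and that all three operators commute with `α`.
`IsActionData` packages these conditions; `isModuleAlgebra_act` and `exists_isActionData` are the
two directions of this dictionary. The first direction uses the degree with `D₁` in degree 1 and
`D₂` in degree -1: sliding an element of degree `n` past `a` replaces `a` by `αⁿ(a)`.

It remains to express these operators through their values on `V` and on the `w_g`. A skew
derivation is determined by those values (`eq_of_generators`). Conversely, prescribed values extend
once they respect the relations `vv' = v'v`, `w_g v = ᵍv w_g` and `w_g w_h = f(g,h) w_{gh}`;
applying the Leibniz rule to these three relations gives three identities for each `d_i`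
(`isSkewDer_skewDer` and the restriction lemmas).

The remaining relations are linear identities between skew derivations. `α d_i` and `d_i α` have the
same twists, as do `d_i S` and `q S d_i`, and `d₁d₂ - d₂d₁` is again a skew derivation, along `S` on
both sides. Hence they need checking on generators only (`isActionData_of_generators`). Nilpotency
is a condition on the full operators in both descriptions. -/

namespace HqMod

/-! ### Skew derivations of an algebra. -/

/-- `d` is a skew derivation along `L` (on the left) and `R` (on the right). -/
def IsSkewDer {k A : Type*} [Field k] [Ring A] [Algebra k A] (L R : A →ₐ[k] A)
    (d : A →ₗ[k] A) : Prop :=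
  ∀ a b : A, d (a * b) = d a * R b + L a * d b

namespace IsSkewDer

variable {k A : Type*} [Field k] [Ring A] [Algebra k A] {L R : A →ₐ[k] A} {d d' : A →ₗ[k] A}

theorem map_one (h : IsSkewDer L R d) : d 1 = 0 := by
  have h1 := h 1 1
  simpa using h1

theorem sub (h : IsSkewDer L R d) (h' : IsSkewDer L R d') : IsSkewDer L R (d - d') := by
  intro a b
  simp only [LinearMap.sub_apply, h a b, h' a b, sub_mul, mul_sub]
  abel

theorem smul (h : IsSkewDer L R d) (r : k) : IsSkewDer L R (r • d) := by
  intro a b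
  simp only [LinearMap.smul_apply, h a b, smul_mul_assoc, mul_smul_comm, smul_add]

theorem comp_algHom (h : IsSkewDer L R d) (F : A →ₐ[k] A) :
    IsSkewDer (L.comp F) (R.comp F) (d ∘ₗ F.toLinearMap) := by
  intro a b
  simp [h (F a) (F b)]

theorem algHom_comp (h : IsSkewDer L R d) (F : A →ₐ[k] A) :
    IsSkewDer (F.comp L) (F.comp R) (F.toLinearMap ∘ₗ d) := by
  intro a b
  simp [h a b]

end IsSkewDer

/-! ### Generators of the crossed product, and uniqueness of skew derivations. -/

namespace CrossedProduct

variable {k G V : Type*} [Field k] [Group G] [AddCommGroup V] [Module k V]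
variable (π : Representation k G V) (f : NormalCocycle k G)

theorem w_one : w π f 1 = 1 := rfl

theorem w_mul_w (g h : G) : w π f g * w π f h = (f.toFun g h : k) • w π f (g * h) := by
  simp [w, term_mul_term]

theorem w_mul_incl (g : G) (P : SymmetricAlgebra k V) :
    w π f g * incl π f P = incl π f (symMap (π g) P) * w π f g := by
  rw [incl_mul_w]
  change term π f g 1 * term π f 1 P = _
  simp [term_mul_term, f.one_right]

theorem w_mul_ofV (g : G) (v : V) :
    w π f g * ofV π f v = ofV π f (π g v) * w π f g := by
  have := w_mul_incl π f g (SymmetricAlgebra.ι k V v)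
  rwa [symMap_ι] at this

variable {π f}

theorem algHom_incl {F : CrossedProduct π f →ₐ[k] CrossedProduct π f} {φ : V →ₗ[k] V}
    (hF : ∀ v, F (ofV π f v) = ofV π f (φ v)) (P : SymmetricAlgebra k V) :
    F (incl π f P) = incl π f (symMap φ P) := by
  induction P using SymmetricAlgebra.induction with
  | algebraMap r => simp only [AlgHom.commutes]
  | ι v => rw [symMap_ι]; exact hF v
  | mul P Q hP hQ => simp only [map_mul, hP, hQ]
  | add P Q hP hQ => simp only [map_add, hP, hQ]

theorem algHom_toLinearMap_eq_diag (F : CrossedProduct π f →ₐ[k] CrossedProduct π f)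
    (φ : V →ₗ[k] V) (χ : G → kˣ) (hV : ∀ v, F (ofV π f v) = ofV π f (φ v))
    (hG : ∀ g, F (w π f g) = (χ g : k) • w π f g) : F.toLinearMap = diag π f φ χ := by
  apply hom_ext
  intro g P
  rw [diag_term, ← incl_mul_w, ← incl_mul_w, AlgHom.toLinearMap_apply, map_mul,
    algHom_incl hV, hG, mul_smul_comm]

theorem diag_ofV (φ : V →ₗ[k] V) {χ : G → kˣ} (hχ : χ 1 = 1) (v : V) :
    diag π f φ χ (ofV π f v) = ofV π f (φ v) := by
  change diag π f φ χ (term π f 1 _) = term π f 1 _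
  simp [hχ, symMap_ι]

theorem diag_w (φ : V →ₗ[k] V) (χ : G → kˣ) (g : G) :
    diag π f φ χ (w π f g) = (χ g : k) • w π f g := by
  simp [w]

theorem diagEquiv_ofV (φ : V ≃ₗ[k] V) (hφ : ∀ g v, φ (π g v) = π g (φ v)) (χ : G →* kˣ) (v : V) :
    diagEquiv π f φ hφ χ (ofV π f v) = ofV π f (φ v) :=
  diag_ofV φ.toLinearMap (map_one χ) v

theorem diagEquiv_w (φ : V ≃ₗ[k] V) (hφ : ∀ g v, φ (π g v) = π g (φ v)) (χ : G →* kˣ) (g : G) :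
    diagEquiv π f φ hφ χ (w π f g) = (χ g : k) • w π f g :=
  diag_w φ.toLinearMap χ g

/-- The square-zero extension `k ⊕ V` is a commutative algebra containing `V`, so its inclusion of
`V` factors through `S(V)`. -/
theorem symmetricAlgebra_ι_injective : Function.Injective (SymmetricAlgebra.ι k V) := by
  -- The algebra structure on `TrivSqZeroExt` asks for a right action of `k` on `V`; it is the left
  -- one, read backwards.
  let _ : Module kᵐᵒᵖ V := Module.compHom V ((RingHom.id k).fromOpposite mul_comm)
  have : IsCentralScalar k V := ⟨fun _ _ => rfl⟩
  have h1 : ∀ v, SymmetricAlgebra.lift (TrivSqZeroExt.inrHom k V) (SymmetricAlgebra.ι k V v) =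
      TrivSqZeroExt.inr v := fun v => by simp
  intro v v' hv
  exact TrivSqZeroExt.inr_injective (R := k) ((h1 v).symm.trans ((congrArg _ hv).trans (h1 v')))

theorem ofV_mul_w_injective (g : G) : Function.Injective fun v => ofV π f v * w π f g := by
  intro v v' hv
  exact symmetricAlgebra_ι_injective (Finsupp.single_injective g
    ((incl_mul_w π f _ g).symm.trans (Eq.trans hv (incl_mul_w π f _ g))))

theorem ofV_injective : Function.Injective (ofV π f) := by
  intro v v' hv
  exact ofV_mul_w_injective (π := π) (f := f) 1 (congrArg (· * w π f 1) hv)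

/-- The augmentation `S(V) → k` killing `V` shows that `1 ≠ 0` in `S(V)`. -/
theorem w_ne_zero (g : G) : w π f g ≠ 0 := by
  intro h
  have := (Finsupp.single_eq_zero (a := g) (b := (1 : SymmetricAlgebra k V))).1 h
  have h1 := congrArg (SymmetricAlgebra.lift (0 : V →ₗ[k] k)) this
  simp at h1

/-- Each term of the Leibniz rule contains a value of `d` on one factor, so the zeros of `d` are
closed under products. -/
theorem _root_.HqMod.IsSkewDer.eq_zero_of_generators
    {L R : CrossedProduct π f →ₐ[k] CrossedProduct π f}
    {d : CrossedProduct π f →ₗ[k] CrossedProduct π f} (h : IsSkewDer L R d)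
    (hV : ∀ v, d (ofV π f v) = 0) (hG : ∀ g, d (w π f g) = 0) : d = 0 := by
  have hP : ∀ P, d (incl π f P) = 0 := by
    intro P
    induction P using SymmetricAlgebra.induction with
    | algebraMap r => rw [AlgHom.commutes, Algebra.algebraMap_eq_smul_one, map_smul, h.map_one,
        smul_zero]
    | ι v => exact hV v
    | mul P Q hP hQ => rw [map_mul, h, hP, hQ, zero_mul, mul_zero, add_zero]
    | add P Q hP hQ => rw [map_add, map_add, hP, hQ, add_zero]
  apply hom_ext
  intro g P
  rw [← incl_mul_w, h, hP, hG, zero_mul, mul_zero, add_zero, LinearMap.zero_apply]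

theorem _root_.HqMod.IsSkewDer.eq_of_generators
    {L R : CrossedProduct π f →ₐ[k] CrossedProduct π f}
    {d d' : CrossedProduct π f →ₗ[k] CrossedProduct π f} (h : IsSkewDer L R d)
    (h' : IsSkewDer L R d') (hV : ∀ v, d (ofV π f v) = d' (ofV π f v))
    (hG : ∀ g, d (w π f g) = d' (w π f g)) : d = d' :=
  sub_eq_zero.1 <| (h.sub h').eq_zero_of_generators
    (fun v => by rw [LinearMap.sub_apply, hV, sub_self])
    (fun g => by rw [LinearMap.sub_apply, hG, sub_self])

/-! ### Existence of skew derivations with prescribed values. -/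

section Skew

variable {a b : V →ₗ[k] V} {d : V →ₗ[k] CrossedProduct π f} (h : SkewSymm π f a b d)

theorem skewDer_term (χ : G → kˣ) (e : G → CrossedProduct π f) (g : G)
    (P : SymmetricAlgebra k V) : skewDer h χ e (term π f g P) =
      skewHom h P 0 1 * ((χ g : k) • w π f g) + incl π f (symMap a P) * e g := by
  simp [skewDer]

theorem skewDer_w (χ : G → kˣ) (e : G → CrossedProduct π f) (g : G) :
    skewDer h χ e (w π f g) = e g := by
  simp [w, skewDer_term]

theorem skewDer_ofV {χ : G → kˣ} {e : G → CrossedProduct π f} (hχ : χ 1 = 1) (he : e 1 = 0)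
    (v : V) : skewDer h χ e (ofV π f v) = d v := by
  change skewDer h χ e (term π f 1 _) = _
  simp [skewDer_term, skewHom_ι, skewMatrix, he, hχ, w_one]

theorem skewHom_mul_offdiag (P Q : SymmetricAlgebra k V) : skewHom h (P * Q) 0 1 =
    incl π f (symMap a P) * skewHom h Q 0 1 + skewHom h P 0 1 * incl π f (symMap b Q) := by
  rw [map_mul, Matrix.mul_apply, Fin.sum_univ_two, (skewHom_diag h P).1, (skewHom_diag h Q).2.2]

/-- On `S(V)` the Leibniz rule is multiplication of upper triangular matrices, read in the upper
right entry. `hV` and `hG` extend it across the relations that move `w_g` past `V` and multiply two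
of the `w_g`. -/
theorem isSkewDer_skewDer {χ : G → kˣ} {e : G → CrossedProduct π f}
    {L R : CrossedProduct π f →ₐ[k] CrossedProduct π f}
    (hLV : ∀ v, L (ofV π f v) = ofV π f (a v)) (hRV : ∀ v, R (ofV π f v) = ofV π f (b v))
    (hRw : ∀ g, R (w π f g) = (χ g : k) • w π f g)
    (hV : ∀ g v, d (π g v) * R (w π f g) + ofV π f (a (π g v)) * e g =
      e g * ofV π f (b v) + L (w π f g) * d v)
    (hG : ∀ g h, (f.toFun g h : k) • e (g * h) = e g * R (w π f h) + L (w π f g) * e h) :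
    IsSkewDer L R (skewDer h χ e) := by
  have hL := fun P => (algHom_incl hLV P).symm
  have hR := fun P => (algHom_incl hRV P).symm
  have hcomm : ∀ (F : CrossedProduct π f →ₐ[k] CrossedProduct π f) (g : G) (P),
      F (w π f g) * F (incl π f P) = F (incl π f (symMap (π g) P)) * F (w π f g) := by
    intro F g P
    rw [← map_mul, w_mul_incl, map_mul]
  have hmul : ∀ P Q, skewHom h (P * Q) 0 1 =
      L (incl π f P) * skewHom h Q 0 1 + skewHom h P 0 1 * R (incl π f Q) := by
    intro P Q
    rw [skewHom_mul_offdiag, hL, hR]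
  have hterm : ∀ g P, skewDer h χ e (term π f g P) =
      skewHom h P 0 1 * R (w π f g) + L (incl π f P) * e g := by
    intro g P
    rw [skewDer_term, hL, hRw]
  -- The two sides are the Leibniz expansions for `(ᵍP) w_g` and `w_g P`, which are the same
  -- element. Compatibility on `V` propagates to products because `L` and `R` are multiplicative.
  have hslide : ∀ (g : G) (P : SymmetricAlgebra k V),
      skewHom h (symMap (π g) P) 0 1 * R (w π f g) + L (incl π f (symMap (π g) P)) * e g =
        e g * R (incl π f P) + L (w π f g) * skewHom h P 0 1 := by
    intro g P
    induction P using SymmetricAlgebra.induction with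
    | algebraMap r =>
      simp [Matrix.algebraMap_eq_diagonal, Algebra.commutes]
    | ι v =>
      have h1 := hV g v
      rw [← hLV, ← hRV] at h1
      simpa [symMap_ι, skewHom_ι, skewMatrix, ofV] using h1
    | mul P Q hP hQ =>
      have h1 := hcomm L g P
      have h2 := hcomm R g Q
      simp only [map_mul (symMap (π g)), hmul, map_mul (incl π f), map_mul L, map_mul R]
      linear_combination (norm := noncomm_ring) L (incl π f (symMap (π g) P)) * hQ +
        hP * R (incl π f Q) - h1 * skewHom h Q 0 1 - skewHom h (symMap (π g) P) 0 1 * h2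
    | add P Q hP hQ =>
      simp only [map_add, Matrix.add_apply]
      linear_combination (norm := noncomm_ring) hP + hQ
  intro x y
  induction x using induction_terms with
  | h0 => simp
  | hadd x₁ x₂ h₁ h₂ => simp only [add_mul, map_add, h₁, h₂]; abel
  | hterm g P =>
    induction y using induction_terms with
    | h0 => simp
    | hadd y₁ y₂ h₁ h₂ => simp only [mul_add, map_add, h₁, h₂]; abel
    | hterm g' Q =>
      have h1 : R (w π f g) * R (w π f g') = (f.toFun g g' : k) • R (w π f (g * g')) := by
        rw [← map_mul, w_mul_w, map_smul]
      have h2 := hcomm L g Q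
      have h3 := hG g g'
      rw [term_mul_term, map_smul, map_smul, hterm, hterm, hterm, hmul, smul_add,
        ← mul_smul_comm, ← mul_smul_comm, ← h1, h3, ← incl_mul_w, ← incl_mul_w]
      simp only [map_mul]
      have h4 := hslide g Q
      -- `h4` moves `w_g` past `Q` inside the product; the other two terms do the same for the
      -- images under `L` and `R`.
      linear_combination (norm := noncomm_ring)
        L (incl π f P) * h4 * R (w π f g') -
          L (incl π f P) * h2 * e g' - skewHom h P 0 1 * (hcomm R g Q) * R (w π f g')

end Skew

/-! The restrictions of a skew derivation to `V` and to the elements `w_g`. -/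

section Restrict

variable {L R : CrossedProduct π f →ₐ[k] CrossedProduct π f} {a b : V →ₗ[k] V}
  {D : CrossedProduct π f →ₗ[k] CrossedProduct π f} {d : V →ₗ[k] CrossedProduct π f}
  {e : G → CrossedProduct π f} (hD : IsSkewDer L R D)
  (hLV : ∀ v, L (ofV π f v) = ofV π f (a v)) (hRV : ∀ v, R (ofV π f v) = ofV π f (b v))
  (hd : ∀ v, D (ofV π f v) = d v) (he : ∀ g, D (w π f g) = e g)

include hD hLV hRV hd in
theorem skewSymm_of_isSkewDer : SkewSymm π f a b d := by
  intro v v'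
  have h1 := congrArg D (ofV_comm (f := f) v v')
  rwa [hD, hD, hLV, hLV, hRV, hRV, hd, hd] at h1

include hD hLV hRV hd he in
theorem slide_of_isSkewDer (g : G) (v : V) :
    d (π g v) * R (w π f g) + ofV π f (a (π g v)) * e g =
      e g * ofV π f (b v) + L (w π f g) * d v := by
  have h1 := congrArg D (w_mul_ofV π f g v)
  rw [hD, hD, hRV, hLV, hd, hd, he] at h1
  exact h1.symm

include hD he in
theorem cocycle_of_isSkewDer (g h : G) :
    (f.toFun g h : k) • e (g * h) = e g * R (w π f h) + L (w π f g) * e h := by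
  have h1 := congrArg D (w_mul_w π f g h)
  rw [hD, map_smul, he, he, he] at h1
  exact h1.symm

include hD hLV hRV hd he in
theorem eq_skewDer_of_isSkewDer (h : SkewSymm π f a b d) {χ : G → kˣ} (hχ : χ 1 = 1)
    (hRw : ∀ g, R (w π f g) = (χ g : k) • w π f g) : D = skewDer h χ e := by
  refine hD.eq_of_generators (isSkewDer_skewDer h hLV hRV hRw
    (slide_of_isSkewDer hD hLV hRV hd he) (cocycle_of_isSkewDer hD he)) (fun v => ?_) fun g => ?_
  · rw [skewDer_ofV h hχ _, hd]
    -- The formula restricts to `d` on `V` only if `e 1 = 0`, which holds because `w_1 = 1` and a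
    -- skew derivation kills `1`.
    rw [← he, w_one, hD.map_one]
  · rw [skewDer_w, he]

end Restrict

end CrossedProduct

/-! ### Homogeneous elements of `H_q`. -/

namespace Hq

variable {k : Type*} [Field k] {q : kˣ}

/-- The degrees of the generators of `H_q` for the grading with `D₁` in degree `1` and `D₂` in
degree `-1`. -/
def deg : HqGen → ℤ
  | .D₁ => 1
  | .D₂ => -1
  | .σ => 0
  | .σinv => 0

variable (q) in
/-- `IsMonomial q n h` says that `h` is a scalar multiple of a product of generators of total
degree `n`. -/
inductive IsMonomial : ℤ → Hq k q → Prop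
  | scalar (r : k) : IsMonomial 0 (algebraMap k (Hq k q) r)
  | gen_mul (y : HqGen) {n : ℤ} {h : Hq k q} :
      IsMonomial n h → IsMonomial (deg y + n) (gen q y * h)

theorem IsMonomial.smul {n : ℤ} {h : Hq k q} (hh : IsMonomial q n h) (r : k) :
    IsMonomial q n (r • h) := by
  induction hh with
  | scalar r' => rw [Algebra.smul_def, ← map_mul]; exact .scalar _
  | gen_mul y _ ih => rw [← mul_smul_comm]; exact .gen_mul y ih

theorem isMonomial_one : IsMonomial q 0 (1 : Hq k q) := by
  simpa using IsMonomial.scalar (q := q) 1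

variable (k q) in
/-- The quotient map from the free algebra to `H_q`. -/
def mk : FreeAlgebra k HqGen →ₐ[k] Hq k q := RingQuot.mkAlgHom k (HqRel k q)

/-- Checking an additive statement on monomials suffices. Only spanning is needed, not that the
degree is unique; sums alone are enough because monomials absorb scalars. -/
theorem mem_closure_isMonomial (h : Hq k q) :
    h ∈ AddSubmonoid.closure {h | ∃ n, IsMonomial q n h} := by
  have hgen : ∀ y, ∀ z ∈ AddSubmonoid.closure {h | ∃ n, IsMonomial q n h},
      gen q y * z ∈ AddSubmonoid.closure {h | ∃ n, IsMonomial q n h} := by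
    intro y z hz
    induction hz using AddSubmonoid.closure_induction with
    | mem z hz => exact AddSubmonoid.subset_closure ⟨_, hz.choose_spec.gen_mul y⟩
    | zero => rw [mul_zero]; exact zero_mem _
    | add z z' _ _ hz hz' => rw [mul_add]; exact add_mem hz hz'
  -- Quantifying over all `z` in the closure lets the product case compose two left multiplications.
  have hmul : ∀ x : FreeAlgebra k HqGen, ∀ z ∈ AddSubmonoid.closure {h | ∃ n, IsMonomial q n h},
      mk k q x * z ∈ AddSubmonoid.closure {h | ∃ n, IsMonomial q n h} := by
    intro x
    induction x using FreeAlgebra.induction with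
    | grade0 r =>
      intro z hz
      rw [AlgHom.commutes, ← Algebra.smul_def]
      induction hz using AddSubmonoid.closure_induction with
      | mem z hz => exact AddSubmonoid.subset_closure ⟨_, hz.choose_spec.smul r⟩
      | zero => rw [smul_zero]; exact zero_mem _
      | add z z' _ _ hz hz' => rw [smul_add]; exact add_mem hz hz'
    | grade1 y => exact hgen y
    | mul x x' hx hx' =>
      intro z hz
      rw [map_mul, mul_assoc]
      exact hx _ (hx' z hz)
    | add x x' hx hx' =>
      intro z hz
      rw [map_add, add_mul]
      exact add_mem (hx z hz) (hx' z hz)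
  obtain ⟨x, rfl⟩ : ∃ x, mk k q x = h := RingQuot.mkAlgHom_surjective k (HqRel k q) h
  simpa only [mul_one] using hmul x 1 (AddSubmonoid.subset_closure ⟨0, isMonomial_one⟩)

@[elab_as_elim]
theorem induction_monomial {p : Hq k q → Prop} (h : Hq k q)
    (mono : ∀ n h, IsMonomial q n h → p h) (add : ∀ h h', p h → p h' → p (h + h')) : p h := by
  induction mem_closure_isMonomial h using AddSubmonoid.closure_induction with
  | mem z hz => exact mono _ z hz.choose_spec
  | zero => simpa using mono 0 _ (.scalar 0)
  | add z z' _ _ hz hz' => exact add z z' hz hz'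

theorem counit_gen (y : HqGen) : Coalgebra.counit (R := k) (gen q y) = counitGen y :=
  counitHom_gen q y

theorem comul_gen (y : HqGen) : Coalgebra.comul (R := k) (gen q y) = comulGen q y :=
  comulHom_gen q y

theorem counit_gen_mul (y : HqGen) (h : Hq k q) :
    Coalgebra.counit (R := k) (gen q y * h) = counitGen y * Coalgebra.counit (R := k) h := by
  rw [Bialgebra.counit_mul, counit_gen]

theorem comul_gen_mul (y : HqGen) (h : Hq k q) :
    Coalgebra.comul (R := k) (gen q y * h) = comulGen q y * Coalgebra.comul (R := k) h := by
  rw [Bialgebra.comul_mul, comul_gen]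

/-- Monomials of nonzero degree are annihilated by the counit. -/
theorem IsMonomial.counit_eq_zero {n : ℤ} {h : Hq k q} (hh : IsMonomial q n h) (hn : n ≠ 0) :
    Coalgebra.counit (R := k) h = 0 := by
  induction hh with
  | scalar => exact absurd rfl hn
  | gen_mul y _ ih =>
    rw [counit_gen_mul]
    cases y with
    | D₁ => exact zero_mul _
    | D₂ => exact zero_mul _
    | σ => rw [ih (by simpa [deg] using hn), mul_zero]
    | σinv => rw [ih (by simpa [deg] using hn), mul_zero]

variable (q) in
/-- The tensors of total degree `n`. -/
def tensorDeg (n : ℤ) : AddSubmonoid (Hq k q ⊗[k] Hq k q) :=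
  AddSubmonoid.closure
    {x | ∃ i j h l, IsMonomial q i h ∧ IsMonomial q j l ∧ i + j = n ∧ x = h ⊗ₜ l}

theorem tmul_mem_tensorDeg {i j n : ℤ} {h l : Hq k q} (hh : IsMonomial q i h)
    (hl : IsMonomial q j l) (hn : i + j = n) : h ⊗ₜ l ∈ tensorDeg q n :=
  AddSubmonoid.subset_closure ⟨i, j, h, l, hh, hl, hn, rfl⟩

/-- Every summand of the coproduct of a generator has the same total degree as the generator. -/
theorem comulGen_mul_mem_tensorDeg (y : HqGen) {n : ℤ} {x : Hq k q ⊗[k] Hq k q}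
    (hx : x ∈ tensorDeg q n) : comulGen q y * x ∈ tensorDeg q (deg y + n) := by
  induction hx using AddSubmonoid.closure_induction with
  | mem x hx =>
    obtain ⟨i, j, h, l, hh, hl, rfl, rfl⟩ := hx
    cases y <;> simp only [comulGen, add_mul, Algebra.TensorProduct.tmul_mul_tmul, one_mul]
    · exact add_mem (tmul_mem_tensorDeg (hh.gen_mul _) (hl.gen_mul _) (by simp [deg]; ring))
        (tmul_mem_tensorDeg hh (hl.gen_mul _) (by simp [deg]; ring))
    · exact add_mem (tmul_mem_tensorDeg (hh.gen_mul _) hl (by simp [deg]; ring))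
        (tmul_mem_tensorDeg (hh.gen_mul _) (hl.gen_mul _) (by simp [deg]; ring))
    · exact tmul_mem_tensorDeg (hh.gen_mul _) (hl.gen_mul _) (by simp [deg])
    · exact tmul_mem_tensorDeg (hh.gen_mul _) (hl.gen_mul _) (by simp [deg])
  | zero => rw [mul_zero]; exact zero_mem _
  | add x x' _ _ hx hx' => rw [mul_add]; exact add_mem hx hx'

theorem IsMonomial.comul_mem_tensorDeg {n : ℤ} {h : Hq k q} (hh : IsMonomial q n h) :
    Coalgebra.comul (R := k) h ∈ tensorDeg q n := by
  induction hh with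
  | scalar r =>
    rw [Bialgebra.comul_algebraMap, Algebra.TensorProduct.algebraMap_apply]
    exact tmul_mem_tensorDeg (.scalar r) isMonomial_one rfl
  | gen_mul y _ ih =>
    rw [comul_gen_mul]
    exact comulGen_mul_mem_tensorDeg y ih

end Hq

/-! ### The good transposition is a left transposition. -/

section Good

variable {k A : Type*} [Field k] {q : kˣ} [Ring A] [Algebra k A] (α : A ≃ₐ[k] A)

/-- The powers of `α` carried by successive generators multiply, so only the degree matters. This
reduces every transposition axiom to a count of degrees. -/
theorem slideHom_monomial {n : ℤ} {h : Hq k q} (hh : Hq.IsMonomial q n h) :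
    slideHom q α h = (α ^ n).toLinearMap ⊗ₜ h := by
  induction hh with
  | scalar r =>
    rw [AlgHom.commutes, Algebra.TensorProduct.algebraMap_apply, Algebra.algebraMap_eq_smul_one,
      Algebra.algebraMap_eq_smul_one, TensorProduct.smul_tmul]
    rfl
  | @gen_mul y n h _ ih =>
    have h1 : slideHom q α (Hq.gen q y) = slideGen α y ⊗ₜ Hq.gen q y := Hq.lift_gen ..
    have h2 : slideGen α y * (α ^ n).toLinearMap = (α ^ (Hq.deg y + n)).toLinearMap := by
      rw [zpow_add]
      ext a
      cases y <;> simp [slideGen, Hq.deg, AlgEquiv.mul_apply]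
    rw [map_mul, ih, h1, Algebra.TensorProduct.tmul_mul_tmul, h2]

theorem goodTransposition_monomial {n : ℤ} {h : Hq k q} (hh : Hq.IsMonomial q n h) (a : A) :
    goodTransposition q α (h ⊗ₜ a) = (α ^ n) a ⊗ₜ h := by
  simp [goodTransposition, slideHom_monomial α hh]

theorem slideTwo_goodTransposition {m n : ℤ} {h l : Hq k q} (hh : Hq.IsMonomial q m h)
    (hl : Hq.IsMonomial q n l) (a : A) :
    slideTwo (goodTransposition q α) (h ⊗ₜ (l ⊗ₜ a)) = (α ^ (m + n)) a ⊗ₜ (h ⊗ₜ l) := by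
  simp [slideTwo, goodTransposition_monomial α hh, goodTransposition_monomial α hl, zpow_add,
    AlgEquiv.mul_apply]

theorem slideTwo_tensorDeg {n : ℤ} {x : Hq k q ⊗[k] Hq k q} (hx : x ∈ Hq.tensorDeg q n) (a : A) :
    slideTwo (goodTransposition q α) (TensorProduct.assoc k _ _ A (x ⊗ₜ a)) =
      (α ^ n) a ⊗ₜ x := by
  induction hx using AddSubmonoid.closure_induction with
  | mem x hx =>
    obtain ⟨i, j, h, l, hh, hl, rfl, rfl⟩ := hx
    rw [TensorProduct.assoc_tmul, slideTwo_goodTransposition α hh hl]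
  | zero => simp
  | add x x' _ _ hx hx' =>
    simp only [TensorProduct.add_tmul, TensorProduct.tmul_add, map_add, hx, hx']

/-- Up to flips, the inverse is the transposition attached to `α⁻¹`. Stating `key` for every `β`
gives both one-sided inverses. -/
theorem goodTransposition_bijective : Function.Bijective (goodTransposition q α) := by
  have key : ∀ β : A ≃ₐ[k] A, ∀ x : Hq k q ⊗[k] A,
      goodTransposition q β⁻¹ (TensorProduct.comm k A (Hq k q) (goodTransposition q β x)) =
        TensorProduct.comm k (Hq k q) A x := by
    intro β x
    induction x using TensorProduct.induction_on with
    | zero => simp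
    | add x x' hx hx' => simp only [map_add, hx, hx']
    | tmul h a =>
      induction h using Hq.induction_monomial with
      | mono n h hh =>
        rw [goodTransposition_monomial β hh, TensorProduct.comm_tmul,
          goodTransposition_monomial _ hh, inv_zpow, TensorProduct.comm_tmul]
        congr 1
        exact (β ^ n).symm_apply_apply a
      | add h h' hh hh' => simp only [TensorProduct.add_tmul, map_add, hh, hh']
  constructor
  · intro x x' hx
    apply (TensorProduct.comm k (Hq k q) A).injective
    rw [← key α, ← key α, hx]
  · intro x
    refine ⟨TensorProduct.comm k A (Hq k q)
      (goodTransposition q α⁻¹ (TensorProduct.comm k A (Hq k q) x)), ?_⟩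
    have h1 := key α⁻¹ (TensorProduct.comm k A (Hq k q) x)
    rw [inv_inv] at h1
    rw [h1]
    exact (TensorProduct.comm k A (Hq k q)).symm_apply_apply x

theorem isLeftTransposition_goodTransposition :
    IsLeftTransposition (TensorProduct.comm k (Hq k q) (Hq k q)) (goodTransposition q α) where
  bijective := goodTransposition_bijective α
  one_tmul a := by
    rw [goodTransposition_monomial α Hq.isMonomial_one, zpow_zero, AlgEquiv.one_apply]
  mul_tmul h l a := by
    induction h using Hq.induction_monomial with
    | add h h' hh hh' => simp only [TensorProduct.add_tmul, add_mul, map_add, hh, hh']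
    | mono m h hh =>
      induction l using Hq.induction_monomial with
      | add l l' hl hl' =>
        simp only [TensorProduct.add_tmul, TensorProduct.tmul_add, mul_add, map_add, hl, hl']
      | mono n l hl =>
        rw [slideTwo_goodTransposition α hh hl]
        have h1 : slideHom q α (h * l) = (α ^ (m + n)).toLinearMap ⊗ₜ (h * l) := by
          rw [map_mul, slideHom_monomial α hh, slideHom_monomial α hl,
            Algebra.TensorProduct.tmul_mul_tmul, zpow_add]
          rfl
        simp [goodTransposition, h1]
  counit_tmul h a := by
    induction h using Hq.induction_monomial with
    | add h h' hh hh' =>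
      simp only [TensorProduct.add_tmul, TensorProduct.tmul_add, map_add, hh, hh']
    | mono n h hh =>
      rw [goodTransposition_monomial α hh, LinearMap.lTensor_tmul]
      -- In degree zero `αⁿ` is the identity; in any other degree the counit vanishes.
      by_cases hn : n = 0
      · rw [hn, zpow_zero, AlgEquiv.one_apply]
      · rw [hh.counit_eq_zero hn, TensorProduct.tmul_zero, TensorProduct.tmul_zero]
  comul_tmul h a := by
    induction h using Hq.induction_monomial with
    | add h h' hh hh' => simp only [TensorProduct.add_tmul, map_add, hh, hh']
    | mono n h hh =>
      rw [goodTransposition_monomial α hh, LinearMap.lTensor_tmul,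
        slideTwo_tensorDeg α hh.comul_mem_tensorDeg]
  braid_tmul h l a := by
    induction h using Hq.induction_monomial with
    | add h h' hh hh' => simp only [TensorProduct.add_tmul, map_add, hh, hh']
    | mono m h hh =>
      induction l using Hq.induction_monomial with
      | add l l' hl hl' =>
        simp only [TensorProduct.add_tmul, TensorProduct.tmul_add, map_add, hl, hl']
      | mono n l hl =>
        rw [slideTwo_goodTransposition α hh hl, TensorProduct.comm_tmul, TensorProduct.assoc_tmul,
          slideTwo_goodTransposition α hl hh, add_comm]
        simp
  tmul_one h := by
    induction h using Hq.induction_monomial with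
    | add h h' hh hh' =>
      simp only [TensorProduct.add_tmul, TensorProduct.tmul_add, map_add, hh, hh']
    | mono n h hh => rw [goodTransposition_monomial α hh, map_one]
  tmul_mul h a b := by
    induction h using Hq.induction_monomial with
    | add h h' hh hh' => simp only [TensorProduct.add_tmul, map_add, hh, hh']
    | mono n h hh =>
      simp [goodTransposition_monomial α hh, slidePast]

end Good

/-! ### From operators to a module algebra. -/

/-- Operators on an algebra `A` by which `D₁`, `D₂` and `σ` act in a module algebra structure on
`(A, s)`, where `s` is the good transposition attached to `α`. -/
structure IsActionData {k A : Type*} [Field k] [Ring A] [Algebra k A] (q : kˣ) (α S : A ≃ₐ[k] A)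
    (d₁ d₂ : Module.End k A) : Prop where
  skew₁ : IsSkewDer (α : A →ₐ[k] A) (S : A →ₐ[k] A) d₁
  skew₂ : IsSkewDer ((S : A →ₐ[k] A).comp (α.symm : A →ₐ[k] A)) (AlgHom.id k A) d₂
  α_S : ∀ a, α (S a) = S (α a)
  α_d₁ : ∀ a, α (d₁ a) = d₁ (α a)
  α_d₂ : ∀ a, α (d₂ a) = d₂ (α a)
  d₁_S : ∀ a, d₁ (S a) = (q : k) • S (d₁ a)
  d₂_S : ∀ a, d₂ (S a) = (q : k) • S (d₂ a)
  d_comm : ∀ a, d₁ (d₂ a) = d₂ (d₁ a)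
  d₁_pow : ∀ l : ℕ, 2 ≤ l → IsPrimitiveRoot (q : k) l → d₁ ^ l = 0
  d₂_pow : ∀ l : ℕ, 2 ≤ l → IsPrimitiveRoot (q : k) l → d₂ ^ l = 0

namespace IsActionData

variable {k A : Type*} [Field k] [Ring A] [Algebra k A] {q : kˣ} {α S : A ≃ₐ[k] A}
  {d₁ d₂ : Module.End k A}

/-- The operators of the generators of `H_q`. -/
def actGen (S : A ≃ₐ[k] A) (d₁ d₂ : Module.End k A) : HqGen → Module.End k A
  | .D₁ => d₁
  | .D₂ => d₂
  | .σ => S.toLinearMap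
  | .σinv => S.symm.toLinearMap

/-- The representation of `H_q` on `A`. -/
def rep (D : IsActionData q α S d₁ d₂) : Hq k q →ₐ[k] Module.End k A :=
  Hq.lift q (actGen S d₁ d₂) (LinearMap.ext D.d_comm) (by ext a; simp [actGen])
    (by ext a; simp [actGen]) (LinearMap.ext D.d₁_S) (LinearMap.ext D.d₂_S) D.d₁_pow D.d₂_pow

variable (D : IsActionData q α S d₁ d₂)
include D

theorem rep_gen (y : HqGen) : D.rep (Hq.gen q y) = actGen S d₁ d₂ y := Hq.lift_gen ..

theorem rep_gen_mul (y : HqGen) (h : Hq k q) (a : A) :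
    D.rep (Hq.gen q y * h) a = actGen S d₁ d₂ y (D.rep h a) := by
  rw [map_mul, Module.End.mul_apply, rep_gen]

theorem actGen_comm (y : HqGen) (a : A) : actGen S d₁ d₂ y (α a) = α (actGen S d₁ d₂ y a) := by
  cases y with
  | D₁ => exact (D.α_d₁ a).symm
  | D₂ => exact (D.α_d₂ a).symm
  | σ => exact (D.α_S a).symm
  | σinv =>
    apply S.injective
    change S (S.symm (α a)) = S (α (S.symm a))
    rw [← D.α_S, S.apply_symm_apply, S.apply_symm_apply]

theorem rep_comm (h : Hq k q) (a : A) : D.rep h (α a) = α (D.rep h a) := by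
  induction h using Hq.induction_monomial with
  | add h h' hh hh' => simp only [map_add, LinearMap.add_apply, hh, hh']
  | mono n h hh =>
    induction hh with
    | scalar r => simp
    | gen_mul y _ ih => rw [D.rep_gen_mul, D.rep_gen_mul, ih, D.actGen_comm]

theorem rep_zpow_comm (h : Hq k q) (n : ℤ) (a : A) : D.rep h ((α ^ n) a) = (α ^ n) (D.rep h a) := by
  have h1 : ∀ a, D.rep h (α⁻¹ a) = α⁻¹ (D.rep h a) := by
    intro a
    apply α.injective
    rw [← D.rep_comm]
    exact (congrArg (D.rep h) (α.apply_symm_apply a)).trans (α.apply_symm_apply _).symm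
  have h2 : ∀ (β : A ≃ₐ[k] A), (∀ a, D.rep h (β a) = β (D.rep h a)) →
      ∀ (m : ℕ) a, D.rep h ((β ^ m) a) = (β ^ m) (D.rep h a) := by
    intro β hβ m
    induction m with
    | zero => simp
    | succ m ih => intro a; rw [pow_succ', AlgEquiv.mul_apply, AlgEquiv.mul_apply, hβ, ih]
  obtain ⟨m, rfl | rfl⟩ := n.eq_nat_or_neg
  · simpa using h2 α (D.rep_comm h) m a
  · simpa using h2 α⁻¹ h1 m a

/-- The action map of the module algebra structure. -/
def act : Hq k q ⊗[k] A →ₗ[k] A := TensorProduct.lift D.rep.toLinearMap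

@[simp]
theorem act_tmul (h : Hq k q) (a : A) : D.act (h ⊗ₜ a) = D.rep h a := by
  simp [act]

/-- Only the right tensor factor slides past `a`, so its degree alone determines the power of `α`,
which then commutes with the action of `h`. -/
theorem act_mul_slideMid {n : ℤ} (h : Hq k q) {l : Hq k q} (hl : Hq.IsMonomial q n l) (a b : A) :
    LinearMap.mul' k A (TensorProduct.map D.act D.act
      (slideMid (goodTransposition q α) ((h ⊗ₜ l) ⊗ₜ (a ⊗ₜ b)))) =
        (α ^ n) (D.rep h a) * D.rep l b := by
  simp [slideMid, goodTransposition_monomial α hl, D.rep_zpow_comm]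

theorem actGen_zpow_comm (y : HqGen) (n : ℤ) (a : A) :
    actGen S d₁ d₂ y ((α ^ n) a) = (α ^ n) (actGen S d₁ d₂ y a) := by
  rw [← D.rep_gen, D.rep_zpow_comm]

/-- The inductive step for the product axiom: the twisted Leibniz rule of a generator is left
multiplication by its coproduct. -/
theorem actGen_act_mul (y : HqGen) (x : Hq k q ⊗[k] Hq k q) (a b : A) :
    actGen S d₁ d₂ y (LinearMap.mul' k A (TensorProduct.map D.act D.act
      (slideMid (goodTransposition q α) (x ⊗ₜ (a ⊗ₜ b))))) =
    LinearMap.mul' k A (TensorProduct.map D.act D.act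
      (slideMid (goodTransposition q α) ((Hq.comulGen q y * x) ⊗ₜ (a ⊗ₜ b)))) := by
  induction x using TensorProduct.induction_on with
  | zero => simp
  | add x x' hx hx' => simp only [mul_add, TensorProduct.add_tmul, map_add, hx, hx']
  | tmul h l =>
    induction l using Hq.induction_monomial with
    | add l l' hl hl' =>
      simp only [mul_add, TensorProduct.tmul_add, TensorProduct.add_tmul, map_add, hl, hl']
    | mono n l hl =>
      rw [D.act_mul_slideMid h hl]
      cases y <;> simp only [Hq.comulGen, add_mul, Algebra.TensorProduct.tmul_mul_tmul, one_mul,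
        TensorProduct.add_tmul, map_add]
      · rw [D.act_mul_slideMid _ (hl.gen_mul _), D.act_mul_slideMid _ (hl.gen_mul _),
          D.rep_gen_mul, D.rep_gen_mul, D.rep_gen_mul]
        have h1 := D.skew₁ ((α ^ n) (D.rep h a)) (D.rep l b)
        have h2 := D.actGen_zpow_comm .D₁ n (D.rep h a)
        simp only [actGen, Hq.deg, zpow_add, zpow_one, zpow_zero, one_mul, AlgEquiv.mul_apply]
          at h2 ⊢
        rw [h1, h2]
        rfl
      · rw [D.act_mul_slideMid _ hl, D.act_mul_slideMid _ (hl.gen_mul _),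
          D.rep_gen_mul, D.rep_gen_mul, D.rep_gen_mul]
        have h1 := D.skew₂ ((α ^ n) (D.rep h a)) (D.rep l b)
        have h2 := D.actGen_zpow_comm .D₂ n (D.rep h a)
        -- In the summand coming from `σ ⊗ D₂`, the right factor `D₂ l` has degree `-1 + n`. Its
        -- extra `α⁻¹` is the one in the left twist `S ∘ α⁻¹` of `d₂`.
        have h3 := D.actGen_zpow_comm .σ (-1 + n) (D.rep h a)
        simp only [actGen, Hq.deg, AlgEquiv.toLinearMap_apply] at h2 h3 ⊢
        rw [h1, h2, ← h3, zpow_add, zpow_neg_one]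
        rfl
      · rw [D.act_mul_slideMid _ (hl.gen_mul _), D.rep_gen_mul, D.rep_gen_mul,
          ← D.actGen_zpow_comm, Hq.deg, zero_add]
        exact map_mul S _ _
      · rw [D.act_mul_slideMid _ (hl.gen_mul _), D.rep_gen_mul, D.rep_gen_mul,
          ← D.actGen_zpow_comm, Hq.deg, zero_add]
        exact map_mul S.symm _ _

theorem rep_one (h : Hq k q) : D.rep h 1 = Coalgebra.counit (R := k) h • (1 : A) := by
  induction h using Hq.induction_monomial with
  | add h h' hh hh' => simp only [map_add, LinearMap.add_apply, add_smul, hh, hh']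
  | mono n h hh =>
    induction hh with
    | scalar r => simp
    | gen_mul y _ ih =>
      have h1 : actGen S d₁ d₂ y 1 = (Hq.counitGen y : k) • (1 : A) := by
        cases y with
        | D₁ => simpa [actGen, Hq.counitGen] using D.skew₁.map_one
        | D₂ => simpa [actGen, Hq.counitGen] using D.skew₂.map_one
        | σ => simp [actGen, Hq.counitGen]
        | σinv => simp [actGen, Hq.counitGen]
      rw [D.rep_gen_mul, ih, map_smul, h1, Hq.counit_gen_mul, smul_smul, mul_comm]

theorem isModuleAlgebra_act :
    IsModuleAlgebra (TensorProduct.comm k (Hq k q) (Hq k q)) (goodTransposition q α) D.act where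
  transposition := isLeftTransposition_goodTransposition α
  one_act a := by simp
  mul_act h l a := by simp
  braid_act h l a := by
    induction h using Hq.induction_monomial with
    | add h h' hh hh' => simp only [TensorProduct.add_tmul, map_add, hh, hh']
    | mono n h hh => simp [goodTransposition_monomial α hh, D.rep_zpow_comm]
  act_mul h a b := by
    induction h using Hq.induction_monomial with
    | add h h' hh hh' => simp only [TensorProduct.add_tmul, map_add, hh, hh']
    | mono n h hh =>
      induction hh with
      | scalar r =>
        rw [Bialgebra.comul_algebraMap, Algebra.TensorProduct.algebraMap_apply,
          D.act_mul_slideMid _ Hq.isMonomial_one]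
        simp
      | gen_mul y _ ih =>
        rw [D.act_tmul] at ih ⊢
        rw [D.rep_gen_mul, ih, D.actGen_act_mul, Hq.comul_gen_mul]
  act_one h := by rw [D.act_tmul, D.rep_one]

end IsActionData

/-! ### From a module algebra to operators. -/

section Restrict

variable {k A : Type*} [Field k] {q : kˣ} [Ring A] [Algebra k A] {α : A ≃ₐ[k] A}
  {ρ : Hq k q ⊗[k] A →ₗ[k] A}

-- Makes it possible to cancel `D₁` from a tensor `a ⊗ D₁`. The witness is a matrix entry of the
-- two-dimensional representation with `D₁` the elementary nilpotent matrix, `σ = diag(1, q)` and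
-- `D₂ = 0`; since `D₁² = 0`, it respects any power relation with `l ≥ 2`.
variable (q) in
theorem Hq.exists_functional_D₁ : ∃ φ : Hq k q →ₗ[k] k, φ (Hq.D₁ q) = 1 := by
  let x : HqGen → Matrix (Fin 2) (Fin 2) k := fun
    | .D₁ => !![0, 1; 0, 0]
    | .D₂ => 0
    | .σ => !![1, 0; 0, (q : k)]
    | .σinv => !![1, 0; 0, (q : k)⁻¹]
  let F : Hq k q →ₐ[k] Matrix (Fin 2) (Fin 2) k := Hq.lift q x (by simp [x])
    (by simp [x, Matrix.one_fin_two]) (by simp [x, Matrix.one_fin_two])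
    (by ext i j; fin_cases i <;> fin_cases j <;> simp [x])
    (by simp [x])
    (fun l hl _ => by
      have h1 : x .D₁ ^ 2 = 0 := by
        rw [pow_two]
        ext i j
        fin_cases i <;> fin_cases j <;> simp [x]
      exact pow_eq_zero_of_le hl h1)
    (fun l hl _ => zero_pow (by omega))
  refine ⟨Matrix.entryLinearMap k k (0 : Fin 2) (1 : Fin 2) ∘ₗ F.toLinearMap, ?_⟩
  have h1 : F (Hq.D₁ q) = x .D₁ := Hq.lift_gen ..
  simp [h1, x]

namespace IsModuleAlgebra

variable (M : IsModuleAlgebra (TensorProduct.comm k (Hq k q) (Hq k q))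
  (goodTransposition q α) ρ)
include M

/-- Braiding `D₁` past the action of `h` gives `α(h · a) ⊗ D₁ = (h · α(a)) ⊗ D₁`; a functional with
value `1` on `D₁` removes the second factor. -/
theorem act_comm (h : Hq k q) (a : A) : ρ (h ⊗ₜ α a) = α (ρ (h ⊗ₜ a)) := by
  obtain ⟨φ, hφ⟩ := Hq.exists_functional_D₁ q
  have h1 := congrArg (TensorProduct.rid k A ∘ φ.lTensor A) (M.braid_act (Hq.D₁ q) h a)
  simpa [goodTransposition_gen, slideGen, hφ] using h1.symm

theorem D₁_mul (a b : A) : ρ (Hq.D₁ q ⊗ₜ (a * b)) =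
    ρ (Hq.D₁ q ⊗ₜ a) * ρ (Hq.σ q ⊗ₜ b) + α a * ρ (Hq.D₁ q ⊗ₜ b) := by
  rw [M.act_mul, Hq.comul_gen]
  simp [Hq.comulGen, TensorProduct.add_tmul, slideMid, goodTransposition_gen, slideGen, M.one_act]

theorem D₂_mul (a b : A) : ρ (Hq.D₂ q ⊗ₜ (a * b)) =
    ρ (Hq.D₂ q ⊗ₜ a) * b + ρ (Hq.σ q ⊗ₜ α.symm a) * ρ (Hq.D₂ q ⊗ₜ b) := by
  rw [M.act_mul, Hq.comul_gen]
  simp [Hq.comulGen, TensorProduct.add_tmul, slideMid, goodTransposition_gen, slideGen, M.one_act,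
    M.transposition.one_tmul]

theorem σ_mul (a b : A) : ρ (Hq.σ q ⊗ₜ (a * b)) = ρ (Hq.σ q ⊗ₜ a) * ρ (Hq.σ q ⊗ₜ b) := by
  rw [M.act_mul, Hq.comul_gen]
  simp [Hq.comulGen, slideMid, goodTransposition_gen, slideGen]

theorem exists_isActionData : ∃ S : A ≃ₐ[k] A, (∀ a, S a = ρ (Hq.σ q ⊗ₜ a)) ∧
    IsActionData q α S (TensorProduct.curry ρ (Hq.D₁ q)) (TensorProduct.curry ρ (Hq.D₂ q)) := by
  let F : Hq k q →ₐ[k] Module.End k A := AlgHom.ofLinearMap (TensorProduct.curry ρ)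
    (LinearMap.ext M.one_act) (fun h l => LinearMap.ext (M.mul_act h l))
  have hF : ∀ h a, F h a = ρ (h ⊗ₜ a) := fun _ _ => rfl
  have h1 : ∀ a, ρ (Hq.σ q ⊗ₜ ρ (Hq.σinv q ⊗ₜ a)) = a := fun a => by
    rw [← M.mul_act, Hq.σ_inv, M.one_act]
  have h2 : ∀ a, ρ (Hq.σinv q ⊗ₜ ρ (Hq.σ q ⊗ₜ a)) = a := fun a => by
    rw [← M.mul_act, Hq.inv_σ, M.one_act]
  let S : A ≃ₐ[k] A := AlgEquiv.ofLinearEquiv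
    (LinearEquiv.ofLinearMap (F (Hq.σ q)) (F (Hq.σinv q)) (LinearMap.ext h1) (LinearMap.ext h2))
    (by
      have h3 := M.act_one (Hq.σ q)
      rw [Hq.counit_gen, Hq.counitGen, one_smul] at h3
      exact h3)
    M.σ_mul
  refine ⟨S, fun _ => rfl, ?_⟩
  have hDS : ∀ y, Hq.gen q y * Hq.σ q = (q : k) • (Hq.σ q * Hq.gen q y) → ∀ a,
      ρ (Hq.gen q y ⊗ₜ ρ (Hq.σ q ⊗ₜ a)) = (q : k) • ρ (Hq.σ q ⊗ₜ ρ (Hq.gen q y ⊗ₜ a)) := by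
    intro y hy a
    rw [← M.mul_act, hy, ← M.mul_act, ← TensorProduct.smul_tmul', map_smul]
  have hpow : ∀ h l, h ^ l = 0 → F h ^ l = 0 := by
    intro h l hl
    rw [← map_pow, hl, map_zero]
  exact {
    skew₁ := M.D₁_mul
    skew₂ := M.D₂_mul
    α_S := fun a => (M.act_comm (Hq.σ q) a).symm
    α_d₁ := fun a => (M.act_comm (Hq.D₁ q) a).symm
    α_d₂ := fun a => (M.act_comm (Hq.D₂ q) a).symm
    d₁_S := hDS .D₁ (Hq.D₁_σ q)
    d₂_S := hDS .D₂ (Hq.D₂_σ q)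
    d_comm := fun a => by
      simp only [TensorProduct.curry_apply]
      rw [← M.mul_act, ← M.mul_act, Hq.D_comm]
    d₁_pow := fun l hl hq => hpow _ l (Hq.D₁_pow q hl hq)
    d₂_pow := fun l hl hq => hpow _ l (Hq.D₂_pow q hl hq) }

end IsModuleAlgebra

end Restrict

/-! ### The commutator of `d₁` and `d₂`. -/

namespace IsSkewDer

variable {k A : Type*} [Field k] [Ring A] [Algebra k A] {q : k} {α S : A ≃ₐ[k] A}
  {d₁ d₂ : Module.End k A}

/-- The commutator of the two skew derivations is a skew derivation along `S`. -/
theorem commutator (h₁ : IsSkewDer (α : A →ₐ[k] A) (S : A →ₐ[k] A) d₁)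
    (h₂ : IsSkewDer ((S : A →ₐ[k] A).comp (α.symm : A →ₐ[k] A)) (AlgHom.id k A) d₂)
    (hαS : ∀ a, α (S a) = S (α a)) (hα₁ : ∀ a, α (d₁ a) = d₁ (α a))
    (hα₂ : ∀ a, α (d₂ a) = d₂ (α a)) (hS₁ : ∀ a, d₁ (S a) = q • S (d₁ a))
    (hS₂ : ∀ a, d₂ (S a) = q • S (d₂ a)) :
    IsSkewDer (S : A →ₐ[k] A) (S : A →ₐ[k] A) (d₁ * d₂ - d₂ * d₁) := by
  have h₁' : ∀ a b, d₁ (a * b) = d₁ a * S b + α a * d₁ b := h₁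
  have h₂' : ∀ a b, d₂ (a * b) = d₂ a * b + S (α.symm a) * d₂ b := h₂
  have e1 : ∀ a, α (S (α.symm a)) = S a := fun a => by rw [hαS, α.apply_symm_apply]
  have e2 : ∀ a, d₁ (α.symm a) = α.symm (d₁ a) := fun a => by
    apply α.injective
    rw [hα₁, α.apply_symm_apply, α.apply_symm_apply]
  intro a b
  simp only [LinearMap.sub_apply, Module.End.mul_apply, AlgEquiv.coe_toAlgHom]
  -- The mixed terms cancel in pairs: `α(d₂ a) d₁ b` with `d₂(α a) d₁ b`, and the two terms in
  -- `S(α⁻¹(d₁ a)) S(d₂ b)`, which acquire the same factor `q`, one from `d₁ S`, the other from `d₂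
  -- S`.
  rw [h₂', map_add, h₁', h₁', h₁' a b, map_add, h₂', h₂', e1, α.symm_apply_apply, hS₁, hS₂, e2,
    hα₂, smul_mul_assoc, mul_smul_comm]
  noncomm_ring

end IsSkewDer

/-! ### Diagonal automorphisms, and reduction of the relations to generators. -/

namespace CrossedProduct

variable {k G V : Type*} [Field k] [Group G] [AddCommGroup V] [Module k V]
variable {π : Representation k G V} {f : NormalCocycle k G} {q : kˣ}

theorem diagEquiv_symm_ofV (φ : V ≃ₗ[k] V) (hφ : ∀ g v, φ (π g v) = π g (φ v)) (χ : G →* kˣ)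
    (v : V) : (diagEquiv π f φ hφ χ).symm (ofV π f v) = ofV π f (φ.symm v) := by
  rw [AlgEquiv.symm_apply_eq, diagEquiv_ofV, φ.apply_symm_apply]

theorem diagEquiv_symm_w (φ : V ≃ₗ[k] V) (hφ : ∀ g v, φ (π g v) = π g (φ v)) (χ : G →* kˣ)
    (g : G) : (diagEquiv π f φ hφ χ).symm (w π f g) = (((χ g)⁻¹ : kˣ) : k) • w π f g := by
  rw [AlgEquiv.symm_apply_eq, map_smul, diagEquiv_w, smul_smul, Units.inv_mul, one_smul]

theorem comp_diagEquiv_symm_ofV {S : CrossedProduct π f ≃ₐ[k] CrossedProduct π f}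
    (φ : V ≃ₗ[k] V) (hφ : ∀ g v, φ (π g v) = π g (φ v)) (χ : G →* kˣ) {ψ : V →ₗ[k] V}
    (hS : ∀ v, S (ofV π f v) = ofV π f (ψ v)) (v : V) :
    (S : CrossedProduct π f →ₐ[k] CrossedProduct π f).comp
      ((diagEquiv π f φ hφ χ).symm : CrossedProduct π f →ₐ[k] CrossedProduct π f) (ofV π f v) =
        ofV π f ((ψ ∘ₗ φ.symm.toLinearMap) v) := by
  simp [diagEquiv_symm_ofV, hS]

theorem comp_diagEquiv_symm_w {S : CrossedProduct π f ≃ₐ[k] CrossedProduct π f}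
    (φ : V ≃ₗ[k] V) (hφ : ∀ g v, φ (π g v) = π g (φ v)) (χ : G →* kˣ) {χ' : G → kˣ}
    (hS : ∀ g, S (w π f g) = (χ' g : k) • w π f g) (g : G) :
    (S : CrossedProduct π f →ₐ[k] CrossedProduct π f).comp
      ((diagEquiv π f φ hφ χ).symm : CrossedProduct π f →ₐ[k] CrossedProduct π f) (w π f g) =
        ((χ' g * (χ g)⁻¹ : kˣ) : k) • w π f g := by
  simp [diagEquiv_symm_w, hS, smul_smul, mul_comm]

/-- An algebra automorphism of the crossed product which acts diagonally on `V` and on the `w_g`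
is given by a bijective `k[G]`-linear map and a character. -/
theorem diagonal_of_algEquiv [FiniteDimensional k V]
    {S : CrossedProduct π f ≃ₐ[k] CrossedProduct π f} {φ : V →ₗ[k] V} {χ : G → kˣ}
    (hV : ∀ v, S (ofV π f v) = ofV π f (φ v)) (hG : ∀ g, S (w π f g) = (χ g : k) • w π f g) :
    Function.Bijective φ ∧ (∀ g v, φ (π g v) = π g (φ v)) ∧
      ∀ g h, χ (g * h) = χ g * χ h := by
  refine ⟨?_, fun g v => ?_, fun g h => ?_⟩
  · have hinj : Function.Injective φ := fun v v' hv =>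
      ofV_injective (π := π) (f := f) (S.injective (by rw [hV, hV, hv]))
    -- Injectivity is inherited from `S`; surjectivity uses that `V` is finite-dimensional.
    exact ⟨hinj, LinearMap.injective_iff_surjective.1 hinj⟩
  · have h1 := congrArg S (w_mul_ofV π f g v)
    rw [map_mul, map_mul, hV, hV, hG, smul_mul_assoc, mul_smul_comm, w_mul_ofV] at h1
    exact (ofV_mul_w_injective g (smul_right_injective _ (χ g).ne_zero h1)).symm
  · have h1 := congrArg S (w_mul_w π f g h)
    rw [map_mul, map_smul, hG, hG, hG, smul_mul_smul_comm, w_mul_w, smul_comm] at h1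
    have h2 := smul_left_injective k (w_ne_zero (π := π) (f := f) (g * h))
      (smul_right_injective _ (f.toFun g h).ne_zero h1)
    exact Units.ext h2.symm

variable {α S : CrossedProduct π f ≃ₐ[k] CrossedProduct π f}
  {d₁ d₂ : Module.End k (CrossedProduct π f)}

/-- The commutation rules of the operators hold as soon as they hold on generators. -/
theorem isActionData_of_generators
    (h₁ : IsSkewDer (α : CrossedProduct π f →ₐ[k] CrossedProduct π f)
      (S : CrossedProduct π f →ₐ[k] CrossedProduct π f) d₁)
    (h₂ : IsSkewDer ((S : CrossedProduct π f →ₐ[k] CrossedProduct π f).comp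
      (α.symm : CrossedProduct π f →ₐ[k] CrossedProduct π f)) (AlgHom.id k _) d₂)
    (hαS : ∀ a, α (S a) = S (α a))
    (hα₁V : ∀ v, α (d₁ (ofV π f v)) = d₁ (α (ofV π f v)))
    (hα₁G : ∀ g, α (d₁ (w π f g)) = d₁ (α (w π f g)))
    (hα₂V : ∀ v, α (d₂ (ofV π f v)) = d₂ (α (ofV π f v)))
    (hα₂G : ∀ g, α (d₂ (w π f g)) = d₂ (α (w π f g)))
    (hS₁V : ∀ v, d₁ (S (ofV π f v)) = (q : k) • S (d₁ (ofV π f v)))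
    (hS₁G : ∀ g, d₁ (S (w π f g)) = (q : k) • S (d₁ (w π f g)))
    (hS₂V : ∀ v, d₂ (S (ofV π f v)) = (q : k) • S (d₂ (ofV π f v)))
    (hS₂G : ∀ g, d₂ (S (w π f g)) = (q : k) • S (d₂ (w π f g)))
    (hV : ∀ v, d₁ (d₂ (ofV π f v)) = d₂ (d₁ (ofV π f v)))
    (hG : ∀ g, d₁ (d₂ (w π f g)) = d₂ (d₁ (w π f g)))
    (hp₁ : ∀ l : ℕ, 2 ≤ l → IsPrimitiveRoot (q : k) l → d₁ ^ l = 0)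
    (hp₂ : ∀ l : ℕ, 2 ≤ l → IsPrimitiveRoot (q : k) l → d₂ ^ l = 0) :
    IsActionData q α S d₁ d₂ := by
  have hSα : ∀ a, S (α.symm a) = α.symm (S a) := fun a => by
    apply α.injective
    rw [hαS, α.apply_symm_apply, α.apply_symm_apply]
  -- The twists are compared pointwise because pairs such as `α ∘ S` and `S ∘ α` agree only through
  -- the commutation hypotheses.
  have of : ∀ {L L' R R' : CrossedProduct π f →ₐ[k] CrossedProduct π f}
      {d d' : CrossedProduct π f →ₗ[k] CrossedProduct π f}, IsSkewDer L R d → IsSkewDer L' R' d' →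
      (∀ a, L a = L' a) → (∀ a, R a = R' a) → (∀ v, d (ofV π f v) = d' (ofV π f v)) →
      (∀ g, d (w π f g) = d' (w π f g)) → ∀ a, d a = d' a := by
    intro L L' R R' d d' hd hd' hL hR hdV hdG
    obtain rfl : L = L' := AlgHom.ext hL
    obtain rfl : R = R' := AlgHom.ext hR
    exact fun a => DFunLike.congr_fun (hd.eq_of_generators hd' hdV hdG) a
  have hα₁ := of (h₁.algHom_comp α) (h₁.comp_algHom α) (fun _ => rfl) hαS hα₁V hα₁G
  have hα₂ := of (h₂.algHom_comp α) (h₂.comp_algHom α)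
    (fun a => by simp [hSα]) (fun _ => rfl) hα₂V hα₂G
  have hS₁ := of (h₁.comp_algHom S) ((h₁.algHom_comp S).smul (q : k)) hαS (fun _ => rfl) hS₁V hS₁G
  have hS₂ := of (h₂.comp_algHom S) ((h₂.algHom_comp S).smul (q : k))
    (fun a => by simp [hSα]) (fun _ => rfl) hS₂V hS₂G
  have hc := (h₁.commutator h₂ hαS hα₁ hα₂ hS₁ hS₂).eq_zero_of_generators
    (fun v => sub_eq_zero.2 (hV v)) (fun g => sub_eq_zero.2 (hG g))
  exact ⟨h₁, h₂, hαS, hα₁, hα₂, hS₁, hS₂, fun a => DFunLike.congr_fun (sub_eq_zero.1 hc) a,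
    hp₁, hp₂⟩

end CrossedProduct

end HqMod

end

/-! ### The equivalence. -/

theorem mainTheorem4 {k G V : Type*} [Field k] [Group G] [AddCommGroup V] [Module k V]
    [FiniteDimensional k V] (q : kˣ) (π : Representation k G V) (f : NormalCocycle k G)
    -- the data `α̂`, `χ_α` that determine `α` and the good transposition `s`
    (αhat : V ≃ₗ[k] V) (hα : ∀ (g : G) (v : V), αhat (π g v) = π g (αhat v)) (χα : G →* kˣ)
    -- the prescribed values
    (δhat₁ δhat₂ : V →ₗ[k] CrossedProduct π f) (ςhat : V →ₗ[k] V)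
    (δbar₁ δbar₂ : G → CrossedProduct π f) (χς : G → kˣ) :
    (∃ ρ : Hq k q ⊗[k] CrossedProduct π f →ₗ[k] CrossedProduct π f,
        IsModuleAlgebra (TensorProduct.comm k (Hq k q) (Hq k q))
          (goodTransposition q (diagEquiv π f αhat hα χα)) ρ ∧
        (∀ v, ρ (Hq.σ q ⊗ₜ ofV π f v) = ofV π f (ςhat v)) ∧
        (∀ g, ρ (Hq.σ q ⊗ₜ w π f g) = (χς g : k) • w π f g) ∧
        (∀ v, ρ (Hq.D₁ q ⊗ₜ ofV π f v) = δhat₁ v) ∧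
        (∀ v, ρ (Hq.D₂ q ⊗ₜ ofV π f v) = δhat₂ v) ∧
        (∀ g, ρ (Hq.D₁ q ⊗ₜ w π f g) = δbar₁ g) ∧
        (∀ g, ρ (Hq.D₂ q ⊗ₜ w π f g) = δbar₂ g)) ↔
    -- (1)
    ((Function.Bijective ςhat ∧ (∀ (g : G) (v : V), ςhat (π g v) = π g (ςhat v)) ∧
        ∀ g h : G, χς (g * h) = χς g * χς h) ∧
      -- (2), the symmetry conditions, which make `δ₁` and `δ₂` in (6) well defined
      ∃ (h₁ : SkewSymm π f αhat.toLinearMap ςhat δhat₁)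
        (h₂ : SkewSymm π f (ςhat ∘ₗ αhat.symm.toLinearMap) LinearMap.id δhat₂),
      -- (2), the compatibilities with the group
      (∀ (g : G) (v : V),
        δhat₁ (π g v) * ((χς g : k) • w π f g) + ofV π f (αhat (π g v)) * δbar₁ g =
          δbar₁ g * ofV π f (ςhat v) + (χα g : k) • w π f g * δhat₁ v) ∧
      (∀ g h : G, (f.toFun g h : k) • δbar₁ (g * h) =
          δbar₁ g * ((χς h : k) • w π f h) + (χα g : k) • w π f g * δbar₁ h) ∧
      (∀ (g : G) (v : V),
        δhat₂ (π g v) * w π f g + ofV π f (ςhat (αhat.symm (π g v))) * δbar₂ g =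
          δbar₂ g * ofV π f v + ((χς g * (χα g)⁻¹ : kˣ) : k) • w π f g * δhat₂ v) ∧
      (∀ g h : G, (f.toFun g h : k) • δbar₂ (g * h) =
          δbar₂ g * w π f h + ((χς g * (χα g)⁻¹ : kˣ) : k) • w π f g * δbar₂ h) ∧
      -- (3)
      (∀ v, δhat₁ (αhat v) = diagEquiv π f αhat hα χα (δhat₁ v)) ∧
      (∀ v, δhat₂ (αhat v) = diagEquiv π f αhat hα χα (δhat₂ v)) ∧
      -- (4)
      (∀ g, (χα g : k) • δbar₁ g = diagEquiv π f αhat hα χα (δbar₁ g)) ∧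
      (∀ g, (χα g : k) • δbar₂ g = diagEquiv π f αhat hα χα (δbar₂ g)) ∧
      -- (5)
      (∀ v, ςhat (αhat v) = αhat (ςhat v)) ∧
      -- (6), where `δ₁ = skewDer h₁ χς δbar₁`, `δ₂ = skewDer h₂ 1 δbar₂` and `ς = diag π f ςhat χς`
      (∀ v, skewDer h₂ 1 δbar₂ (δhat₁ v) = skewDer h₁ χς δbar₁ (δhat₂ v)) ∧
      (∀ v, δhat₁ (ςhat v) = (q : k) • diag π f ςhat χς (δhat₁ v)) ∧
      (∀ v, δhat₂ (ςhat v) = (q : k) • diag π f ςhat χς (δhat₂ v)) ∧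
      (∀ g, skewDer h₂ 1 δbar₂ (δbar₁ g) = skewDer h₁ χς δbar₁ (δbar₂ g)) ∧
      (∀ g, (χς g : k) • δbar₁ g = (q : k) • diag π f ςhat χς (δbar₁ g)) ∧
      (∀ g, (χς g : k) • δbar₂ g = (q : k) • diag π f ςhat χς (δbar₂ g)) ∧
      (∀ l : ℕ, 2 ≤ l → IsPrimitiveRoot (q : k) l →
        skewDer h₁ χς δbar₁ ^ l = 0 ∧ skewDer h₂ 1 δbar₂ ^ l = 0)) := by
  have hLα : ∀ v, (diagEquiv π f αhat hα χα : CrossedProduct π f →ₐ[k] CrossedProduct π f)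
      (ofV π f v) = ofV π f (αhat.toLinearMap v) := diagEquiv_ofV αhat hα χα
  have hLαw := diagEquiv_w (f := f) αhat hα χα
  constructor
  · rintro ⟨ρ, M, hσV, hσG, h₁V, h₂V, h₁G, h₂G⟩
    obtain ⟨S, hS, D⟩ := M.exists_isActionData
    have hSV : ∀ v, S (ofV π f v) = ofV π f (ςhat v) := fun v => (hS _).trans (hσV v)
    have hSw : ∀ g, S (w π f g) = (χς g : k) • w π f g := fun g => (hS _).trans (hσG g)
    obtain ⟨hbij, hequiv, hmul⟩ := diagonal_of_algEquiv hSV hSw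
    have hχ : χς 1 = 1 := by simpa using hmul 1 1
    have hdiag : ∀ a, S a = diag π f ςhat χς a := DFunLike.congr_fun (algHom_toLinearMap_eq_diag
      (S : CrossedProduct π f →ₐ[k] CrossedProduct π f) ςhat χς hSV hSw)
    have hL₂ := comp_diagEquiv_symm_ofV αhat hα χα hSV
    have hL₂w := comp_diagEquiv_symm_w αhat hα χα hSw
    have s₁ := skewSymm_of_isSkewDer D.skew₁ hLα hSV h₁V
    have s₂ := skewSymm_of_isSkewDer (b := LinearMap.id) D.skew₂ hL₂ (fun _ => rfl) h₂V
    -- By uniqueness, the operators of `D₁` and `D₂` are the explicit maps `δ₁` and `δ₂`, so the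
    -- relations of `H_q` become statements about these.
    have e₁ := eq_skewDer_of_isSkewDer D.skew₁ hLα hSV h₁V h₁G s₁ hχ hSw
    have e₂ := eq_skewDer_of_isSkewDer D.skew₂ hL₂ (fun _ => rfl) h₂V h₂G s₂ (χ := 1) rfl
      (fun g => by simp)
    refine ⟨⟨hbij, hequiv, hmul⟩, s₁, s₂, fun g v => ?_, fun g h => ?_, fun g v => ?_,
      fun g h => ?_, fun v => ?_, fun v => ?_, fun g => ?_, fun g => ?_, fun v => ?_, fun v => ?_,
      fun v => ?_, fun v => ?_, fun g => ?_, fun g => ?_, fun g => ?_, fun l hl hq => ?_⟩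
    · have h := slide_of_isSkewDer D.skew₁ hLα hSV h₁V h₁G g v
      simpa only [AlgEquiv.coe_toAlgHom, LinearEquiv.coe_coe, hSw, hLαw] using h
    · have h := cocycle_of_isSkewDer D.skew₁ h₁G g h
      simpa only [AlgEquiv.coe_toAlgHom, hSw, hLαw] using h
    · have h := slide_of_isSkewDer (b := LinearMap.id) D.skew₂ hL₂ (fun _ => rfl) h₂V h₂G g v
      rwa [hL₂w] at h
    · have h := cocycle_of_isSkewDer D.skew₂ h₂G g h
      rwa [hL₂w] at h
    · rw [← h₁V, ← h₁V, ← diagEquiv_ofV αhat hα χα]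
      exact (D.α_d₁ _).symm
    · rw [← h₂V, ← h₂V, ← diagEquiv_ofV αhat hα χα]
      exact (D.α_d₂ _).symm
    · rw [← h₁G, ← map_smul, ← TensorProduct.tmul_smul, ← hLαw]
      exact (D.α_d₁ _).symm
    · rw [← h₂G, ← map_smul, ← TensorProduct.tmul_smul, ← hLαw]
      exact (D.α_d₂ _).symm
    · have h := D.α_S (ofV π f v)
      rw [hSV, diagEquiv_ofV, diagEquiv_ofV, hSV] at h
      exact (ofV_injective h).symm
    · rw [← e₁, ← e₂, ← h₁V, ← h₂V]
      exact (D.d_comm _).symm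
    · rw [← h₁V, ← h₁V, ← hdiag, ← hSV]
      exact D.d₁_S _
    · rw [← h₂V, ← h₂V, ← hdiag, ← hSV]
      exact D.d₂_S _
    · rw [← e₁, ← e₂, ← h₁G, ← h₂G]
      exact (D.d_comm _).symm
    · rw [← h₁G, ← map_smul, ← TensorProduct.tmul_smul, ← hSw, ← hdiag]
      exact D.d₁_S _
    · rw [← h₂G, ← map_smul, ← TensorProduct.tmul_smul, ← hSw, ← hdiag]
      exact D.d₂_S _
    · rw [← e₁, ← e₂]
      exact ⟨D.d₁_pow l hl hq, D.d₂_pow l hl hq⟩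
  · rintro ⟨⟨hbij, hequiv, hmul⟩, s₁, s₂, slide₁, cocycle₁, slide₂, cocycle₂, hα₁V, hα₂V, hα₁G,
      hα₂G, hςα, hcV, hς₁V, hς₂V, hcG, hς₁G, hς₂G, hpow⟩
    -- Bundling `ςhat` and `χς` as an equivalence and a character makes `ς` available as the
    -- automorphism `diagEquiv`.
    obtain ⟨ς, rfl⟩ : ∃ ς : V ≃ₗ[k] V, ς.toLinearMap = ςhat :=
      ⟨LinearEquiv.ofBijective ςhat hbij, rfl⟩
    obtain ⟨χ, rfl⟩ : ∃ χ : G →* kˣ, ⇑χ = χς :=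
      ⟨MonoidHom.mk' χς hmul, rfl⟩
    have hSV := diagEquiv_ofV (f := f) ς hequiv χ
    have hSw := diagEquiv_w (f := f) ς hequiv χ
    have hdiag := diagEquiv_apply π f ς hequiv χ
    have hL₂ := comp_diagEquiv_symm_ofV αhat hα χα (ψ := ς.toLinearMap) hSV
    have hL₂w := comp_diagEquiv_symm_w αhat hα χα hSw
    have D₁ := isSkewDer_skewDer s₁ (χ := χ) (e := δbar₁) hLα
      (R := (diagEquiv π f ς hequiv χ : CrossedProduct π f →ₐ[k] CrossedProduct π f)) hSV hSw
      (fun g v => by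
        simpa only [AlgEquiv.coe_toAlgHom, LinearEquiv.coe_coe, hSw, hLαw] using slide₁ g v)
      (fun g h => by simpa only [AlgEquiv.coe_toAlgHom, hSw, hLαw] using cocycle₁ g h)
    have D₂ := isSkewDer_skewDer s₂ (χ := 1) (e := δbar₂) hL₂
      (R := AlgHom.id k _) (fun _ => rfl) (fun g => by simp)
      (fun g v => by rw [hL₂w]; exact slide₂ g v)
      (fun g h => by rw [hL₂w]; exact cocycle₂ g h)
    -- The required `δbar₁ 1 = 0` is not assumed; it follows from the Leibniz rule at `1 = w_1`.
    have v₁ := skewDer_ofV s₁ (map_one χ) ((skewDer_w s₁ χ δbar₁ 1).symm.trans D₁.map_one)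
    have v₂ := skewDer_ofV s₂ (χ := 1) rfl ((skewDer_w s₂ 1 δbar₂ 1).symm.trans D₂.map_one)
    have w₁ := skewDer_w s₁ χ δbar₁
    have w₂ := skewDer_w s₂ 1 δbar₂
    have D : IsActionData q (diagEquiv π f αhat hα χα) (diagEquiv π f ς hequiv χ)
        (skewDer s₁ χ δbar₁) (skewDer s₂ 1 δbar₂) := by
      refine isActionData_of_generators D₁ D₂ (fun a => ?_)
        (fun v => ?_) (fun g => ?_) (fun v => ?_) (fun g => ?_) (fun v => ?_) (fun g => ?_)
        (fun v => ?_) (fun g => ?_) (fun v => ?_) (fun g => ?_)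
        (fun l hl hq => (hpow l hl hq).1) (fun l hl hq => (hpow l hl hq).2)
      · have hcomm : αhat.toLinearMap ∘ₗ ς.toLinearMap = ς.toLinearMap ∘ₗ αhat.toLinearMap :=
          LinearMap.ext fun v => (hςα v).symm
        simp only [diagEquiv_apply]
        induction a using induction_terms with
        | h0 => simp
        | hadd a b ha hb => simp only [map_add, ha, hb]
        | hterm g P =>
          simp only [diag_term, map_smul, symMap_comp, hcomm]
          rw [smul_comm]
      · rw [diagEquiv_ofV, v₁, v₁, hα₁V]
      · rw [hLαw, map_smul, w₁, hα₁G]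
      · rw [diagEquiv_ofV, v₂, v₂, hα₂V]
      · rw [hLαw, map_smul, w₂, hα₂G]
      · rw [hSV, v₁, v₁, hdiag]
        exact hς₁V v
      · rw [hSw, map_smul, w₁, hdiag, hς₁G]
      · rw [hSV, v₂, v₂, hdiag]
        exact hς₂V v
      · rw [hSw, map_smul, w₂, hdiag, hς₂G]
      · rw [v₁, v₂, hcV]
      · rw [w₁, w₂, hcG]
    refine ⟨D.act, D.isModuleAlgebra_act, fun v => ?_, fun g => ?_, fun v => ?_, fun v => ?_,
      fun g => ?_, fun g => ?_⟩ <;> rw [D.act_tmul, D.rep_gen]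
    · exact hSV v
    · exact hSw g
    · exact v₁ v
    · exact v₂ v
    · exact w₁ g
    · exact w₂ g
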